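/- **Setting.** On $\mathbb R^4$ take the Euclidean scalar product $\langle\cdot,\cdot\rangle$ and the symplectic form $\omega(x,y)=\langle L_ix,y\rangle$, i.e. $\omega=dx^1\wedge dx^2+dx^3\wedge dx^4$. Identify $(x^1,x^2,x^3,x^4)$ with the quaternion $x^1+ix^2+jx^3+kx^4$; let $L_i,L_j$ be the real $4\times4$ matrices of left multiplication by $i,j$, and $R_i,R_j,R_k$ those of right multiplication by $i,j,k$. Let $\vec{\mathcal G}\simeq U(2)$ be the group of linear maps preserving $\langle\cdot,\cdot\rangle$ and $\omega$, and let $\mathcal G=\vec{\mathcal G}\ltimes\mathbb R^4$. Its Lie algebra is $\mathfrak g=\{(aL_i+b^1R_i+b^2R_j+b^3R_k,\,t): a,b^1,b^2,b^3\in\mathbb R,\ t\in\mathbb R^4\}$, with bracket $[(\eta,t),(\tilde\eta,\tilde t)]=(\eta\tilde\eta-\tilde\eta\eta,\ \eta\tilde t-\tilde\eta t)$. On $\mathfrak g^{\mathbb C}=\mathfrak g\otimes\mathbb C$ the automorphism $\tau(\eta,t)=(-L_j\eta L_j,-L_jt)$ satisfies $\tau^4=1$; for $k=-1,0,1,2$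 let $[\,\cdot\,]_k$ be the projection onto its eigenspace for the eigenvalue $i^k$ along the other eigenspaces. For a $\mathfrak g$-valued 1-form $\alpha$ on a domain of $\mathbb C$ put $\alpha_k=[\alpha]_k$, and write $\alpha_k=\alpha_k'+\alpha_k''$ with $\alpha_k'=\alpha_k(\partial_z)\,dz$ and $\alpha_k''=\alpha_k(\partial_{\bar z})\,d\bar z$. Let $\Omega\subset\mathbb C$ be a simply connected domain with a base point $z_0\in\Omega$. A *conformal Lagrangian immersion* is a smooth map $X:\Omega\to\mathbb R^4$ with $|X_x|=|X_y|\ne0$, $\langle X_x,X_y\rangle=0$ and $\omega(X_x,X_y)=0$ on $\Omega$. The *Lagrangian angle* $\Theta(u,v)\in\mathbb R/2\pi\mathbb Z$ of an oriented Lagrangian plane with direct basis $(u,v)$ is the argument of $(dx^1+i\,dx^2)\wedge(dx^3+i\,dx^4)(u,v)$. A *lifted conformal Lagrangian immersion* (LCLI) is a smooth map $U=(F,X):\Omega\to\mathcal G$ with $U(z_0)=(1,0)$ such that $X$ is a conformal Lagrangian immersion and $\Theta(X_x,X_y)=\Theta(F\epsilon_1,F\epsilon_3)$ at every point of $\Omega$,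 where $\epsilon_1,\dots,\epsilon_4$ is the standard basis of $\mathbb R^4$. Its Maurer–Cartan form is $U^{-1}dU=(F^{-1}dF,\,F^{-1}dX)$. The immersion $X$ is *Hamiltonian stationary* if $\frac{d}{dt}\big|_{t=0}\operatorname{Area}\big((X+tV)|_{\operatorname{supp}V}\big)=0$ for every smooth vector field $V:\Omega\to\mathbb R^4$ along $X$ with compact support in $\Omega$ that is Hamiltonian, i.e. such that $\omega(V,dX(\cdot))=dh$ for some $h\in C_c^\infty(\Omega,\mathbb R)$. **Theorem.** Let $\alpha$ be a smooth $\mathfrak g$-valued 1-form on $\Omega$. 1. $\alpha$ is the Maurer–Cartan form of an LCLI if and only if $d\alpha+\alpha\wedge\alpha=0$ and $\alpha_{-1}''=\alpha_1'=0$ on $\Omega$, and $\alpha_{-1}'$ and $\alpha_1''$ vanish at no point of $\Omega$. 2. Suppose that $\alpha$ is the Maurer–Cartan form of an LCLI. Then it is the Maurer–Cartan form of an LCLI $(F,X)$ with $X$ Hamiltonian stationary if and only if the extended Maurer–Cartan form $$\alpha_\lambda=\lambda^{-2}\alpha_2'+\lambda^{-1}\alpha_{-1}'+\alpha_0+\lambda\alpha_1''+\lambda^2\alpha_2''$$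 satisfies $d\alpha_\lambda+\alpha_\lambda\wedge\alpha_\lambda=0$ for all $\lambda\in\mathbb C^*$. More precisely, for every LCLI $(F,X)$ with Maurer–Cartan form $\alpha$, $X$ is Hamiltonian stationary if and only if this holds. -/

import Mathlib

open scoped Matrix ContDiff

noncomputable section

namespace HamStat

/-! ### Linear algebra of the Euclidean symplectic space `ℝ⁴ ≃ ℂ² ≃ ℍ` -/

/-- Left multiplication by `i` on `ℍ`; it is also the complex structure `J` of `ℝ⁴ ≃ ℂ²`. -/
def Li (R : Type*) [Ring R] : Matrix (Fin 4) (Fin 4) R :=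
  !![0, -1, 0, 0; 1, 0, 0, 0; 0, 0, 0, -1; 0, 0, 1, 0]

/-- Left multiplication by `j` on `ℍ`. -/
def Lj (R : Type*) [Ring R] : Matrix (Fin 4) (Fin 4) R :=
  !![0, 0, -1, 0; 0, 0, 0, 1; 1, 0, 0, 0; 0, -1, 0, 0]

/-- Right multiplication by `i` on `ℍ`. -/
def Ri (R : Type*) [Ring R] : Matrix (Fin 4) (Fin 4) R :=
  !![0, -1, 0, 0; 1, 0, 0, 0; 0, 0, 0, 1; 0, 0, -1, 0]

/-- Right multiplication by `j` on `ℍ`. -/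
def Rj (R : Type*) [Ring R] : Matrix (Fin 4) (Fin 4) R :=
  !![0, 0, -1, 0; 0, 0, 0, -1; 1, 0, 0, 0; 0, 1, 0, 0]

/-- Right multiplication by `k` on `ℍ`. -/
def Rk (R : Type*) [Ring R] : Matrix (Fin 4) (Fin 4) R :=
  !![0, 0, 0, -1; 0, 0, 1, 0; 0, -1, 0, 0; 1, 0, 0, 0]

/-- The symplectic form `ω(x, y) = ⟨J x, y⟩ = (dx¹ ∧ dx² + dx³ ∧ dx⁴)(x, y)`. The Euclidean scalar
product of `x y : Fin 4 → ℝ` is `x ⬝ᵥ y`. -/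
def omega (x y : Fin 4 → ℝ) : ℝ := (Li ℝ *ᵥ x) ⬝ᵥ y

/-- The linear transformations of `ℝ⁴` that preserve the scalar product and `ω`, a copy of `U(2)`
(the rotation components of the elements of the group `𝒢`). -/
def rotGroup : Set (Matrix (Fin 4) (Fin 4) ℝ) :=
  {G | (∀ x y, (G *ᵥ x) ⬝ᵥ (G *ᵥ y) = x ⬝ᵥ y) ∧ ∀ x y, omega (G *ᵥ x) (G *ᵥ y) = omega x y}

/-- The complex number `(dx¹ + i dx²) ∧ (dx³ + i dx⁴) (u, v)`. -/
def complexVolume (u v : Fin 4 → ℝ) : ℂ :=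
  (u 0 + Complex.I * u 1) * (v 2 + Complex.I * v 3)
    - (v 0 + Complex.I * v 1) * (u 2 + Complex.I * u 3)

/-- The Lagrangian angle `Θ ∈ ℝ / 2πℤ` of the oriented Lagrangian plane with direct basis `(u, v)`:
the argument of `dz¹ ∧ dz² (u, v)`. Changing the direct basis multiplies this number by a positive
real, and for an orthonormal basis it is `exp (i Θ)`. -/
def lagAngle (u v : Fin 4 → ℝ) : Real.Angle := ((complexVolume u v).arg : Real.Angle)

/-! ### The Lie algebra `𝔤` of `𝒢 = U(2) ⋉ ℝ⁴` and its complexification -/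

/-- Pairs `(η, t)` of a 4×4 array (viewed as the matrix `Matrix.of η`) and a vector, i.e.
infinitesimal affine transformations. The array type is used instead of `Matrix` because it carries
a norm. -/
abbrev Aff (R : Type*) : Type _ := (Fin 4 → Fin 4 → R) × (Fin 4 → R)

/-- The rotation component of `(η, t)`, as a matrix. -/
def rot {R : Type*} (ξ : Aff R) : Matrix (Fin 4) (Fin 4) R := Matrix.of ξ.1

/-- The Lie bracket of infinitesimal affine transformations. -/
def bracket {R : Type*} [Ring R] (a b : Aff R) : Aff R :=
  (Matrix.of.symm (rot a * rot b - rot b * rot a), rot a *ᵥ b.2 - rot b *ᵥ a.2)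

/-- The Lie algebra `𝔤` of the group of affine transformations of `ℝ⁴` preserving the scalar
product and `ω`. -/
def lieG : Set (Aff ℝ) :=
  {ξ | ∃ a b₁ b₂ b₃ : ℝ, rot ξ = a • Li ℝ + b₁ • Ri ℝ + b₂ • Rj ℝ + b₃ • Rk ℝ}

/-- The inclusion of real pairs into complex pairs. -/
def complexify : Aff ℝ →L[ℝ] Aff ℂ :=
  LinearMap.toContinuousLinearMap
    { toFun := fun ξ => (fun i j => (ξ.1 i j : ℂ), fun i => (ξ.2 i : ℂ))
      map_add' := by
        intro x y
        ext <;> simp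
      map_smul' := by
        intro c x
        ext <;> simp }

/-- The automorphism `τ (η, t) = (-L_j η L_j, -L_j t)`, i.e. conjugation by `(-L_j, 0)`. -/
def tau : Aff ℂ →ₗ[ℂ] Aff ℂ where
  toFun ξ := (Matrix.of.symm (-(Lj ℂ * rot ξ * Lj ℂ)), -(Lj ℂ *ᵥ ξ.2))
  map_add' x y := by
    have h : rot (x + y) = rot x + rot y := rfl
    ext1
    · simp only [h, mul_add, add_mul, neg_add]; rfl
    · simp only [Prod.snd_add, Matrix.mulVec_add, neg_add]
  map_smul' c x := by
    have h : rot (c • x) = c • rot x := rfl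
    ext1
    · simp only [h, Matrix.mul_smul, Matrix.smul_mul, ← smul_neg]; rfl
    · simp [Matrix.mulVec_smul]

/-- The projection `[·]_k` onto the eigenspace of `τ` for the eigenvalue `i ^ k`
(`k = -1, 0, 1, 2`) along the other eigenspaces, written as `¼ ∑ₘ i ^ (-k m) τ ^ m`
(recall that `τ ^ 4 = 1`). -/
def proj (k : ℤ) : Aff ℂ →ₗ[ℂ] Aff ℂ :=
  (1 / 4 : ℂ) • ∑ m ∈ Finset.range 4, (Complex.I ^ (-(k * (m : ℤ)))) • tau ^ m

theorem Lj_mul_Lj : Lj ℂ * Lj ℂ = -1 := by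
  ext i j
  fin_cases i <;> fin_cases j <;> simp [Lj, Matrix.mul_apply, Fin.sum_univ_four]

theorem tau_sq_apply (ξ : Aff ℂ) : tau (tau ξ) = (ξ.1, -ξ.2) := by
  ext1
  · have h : -(Lj ℂ * -(Lj ℂ * rot ξ * Lj ℂ) * Lj ℂ) = rot ξ := by
      calc -(Lj ℂ * -(Lj ℂ * rot ξ * Lj ℂ) * Lj ℂ)
          = (Lj ℂ * Lj ℂ) * rot ξ * (Lj ℂ * Lj ℂ) := by noncomm_ring
        _ = rot ξ := by rw [Lj_mul_Lj]; simp
    exact h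
  · simp [tau, Matrix.mulVec_neg, Lj_mul_Lj, Matrix.neg_mulVec]

theorem tau_pow_four : tau ^ 4 = 1 := by
  refine LinearMap.ext fun ξ => ?_
  have : (tau ^ 4) ξ = tau (tau (tau (tau ξ))) := by
    simp [pow_succ, Module.End.mul_apply]
  rw [this, tau_sq_apply, tau_sq_apply]
  simp

/-- `[ξ]_k` lies in the eigenspace of `τ` for the eigenvalue `i ^ k`. -/
theorem tau_proj (k : ℤ) (ξ : Aff ℂ) : tau (proj k ξ) = (Complex.I ^ k) • proj k ξ := by
  have h4 : tau (tau (tau (tau ξ))) = ξ := by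
    rw [tau_sq_apply, tau_sq_apply]; simp
  have hI : (Complex.I ^ k) ^ 4 = 1 := by
    rw [← zpow_natCast, ← zpow_mul, mul_comm, zpow_mul]; simp
  have hne : Complex.I ^ k ≠ 0 := zpow_ne_zero _ Complex.I_ne_zero
  have e (m : ℕ) : Complex.I ^ (-(k * (m : ℤ))) = ((Complex.I ^ k)⁻¹) ^ m := by
    rw [zpow_neg, zpow_mul, zpow_natCast, inv_pow]
  simp only [proj, e, Finset.sum_range_succ, Finset.sum_range_zero, LinearMap.smul_apply,
    LinearMap.add_apply, map_smul, map_add, pow_succ, pow_zero, Module.End.mul_apply,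
    Module.End.one_apply, one_mul, zero_add, h4]
  generalize Complex.I ^ k = c at hI hne
  have h3 : c⁻¹ * c⁻¹ * c⁻¹ = c := by
    field_simp
    linear_combination -hI
  rw [h3]
  have h2 : c⁻¹ * c⁻¹ = c * c := by
    field_simp
    linear_combination -hI
  simp only [smul_add, smul_smul]
  have e1 : c * (1 / 4 * (c⁻¹ * c⁻¹)) = 1 / 4 * c⁻¹ := by field_simp
  have e2 : c * (1 / 4 * c⁻¹) = 1 / 4 * 1 := by field_simp
  have e3 : c * (1 / 4 * c) = 1 / 4 * (c⁻¹ * c⁻¹) := by rw [h2]; ring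
  rw [e1, e2, e3, mul_one, mul_comm c]
  abel

/-- Every `ξ` is the sum of its components `[ξ]_{-1}`, `[ξ]_0`, `[ξ]_1`, `[ξ]_2`. -/
theorem sum_proj (ξ : Aff ℂ) : proj (-1) ξ + proj 0 ξ + proj 1 ξ + proj 2 ξ = ξ := by
  have e2 : Complex.I ^ (2 : ℤ) = -1 := by
    rw [show (2 : ℤ) = ((2 : ℕ) : ℤ) by rfl, zpow_natCast, Complex.I_sq]
  have e4 : Complex.I ^ (4 : ℤ) = 1 := by
    rw [show (4 : ℤ) = ((4 : ℕ) : ℤ) by rfl, zpow_natCast, Complex.I_pow_four]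
  have e6 : Complex.I ^ (6 : ℤ) = -1 := by
    rw [show (6 : ℤ) = 4 + 2 by rfl, zpow_add₀ Complex.I_ne_zero, e4, e2, one_mul]
  simp [proj, Finset.sum_range_succ, e2, e4, e6, zpow_neg]
  module

/-! ### Differential forms on plane domains -/

/-- `dθ + θ ∧ θ = 0` on `Ω`, for a 1-form `θ` with values in (complex) infinitesimal affine
transformations, evaluated on pairs of (constant) vectors. -/
def IsFlatOn (Ω : Set ℂ) (θ : ℂ → ℂ →L[ℝ] Aff ℂ) : Prop :=
  ∀ z ∈ Ω, ∀ v w : ℂ,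
    fderiv ℝ θ z v w - fderiv ℝ θ z w v + bracket (θ z v) (θ z w) = 0

/-- The `(1,0)`-part `θ' = θ(∂/∂z) dz`, where `∂/∂z = ½ (∂/∂x - i ∂/∂y)`. -/
def dzPart (θ : ℂ →L[ℝ] Aff ℂ) : ℂ →L[ℝ] Aff ℂ :=
  (ContinuousLinearMap.id ℝ ℂ).smulRight ((1 / 2 : ℂ) • (θ 1 - Complex.I • θ Complex.I))

/-- The `(0,1)`-part `θ'' = θ(∂/∂z̄) dz̄`, where `∂/∂z̄ = ½ (∂/∂x + i ∂/∂y)`. -/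
def dzbarPart (θ : ℂ →L[ℝ] Aff ℂ) : ℂ →L[ℝ] Aff ℂ :=
  (Complex.conjCLE : ℂ →L[ℝ] ℂ).smulRight ((1 / 2 : ℂ) • (θ 1 + Complex.I • θ Complex.I))

/-- The complexified form `α` as a form with values in complex pairs. -/
def complexForm (α : ℂ → ℂ →L[ℝ] Aff ℝ) (z : ℂ) : ℂ →L[ℝ] Aff ℂ :=
  complexify.comp (α z)

/-- The component `α_k = [α]_k`. -/
def component (α : ℂ → ℂ →L[ℝ] Aff ℝ) (k : ℤ) (z : ℂ) : ℂ →L[ℝ] Aff ℂ :=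
  (LinearMap.toContinuousLinearMap ((proj k).restrictScalars ℝ)).comp (complexForm α z)

/-- The extended form
`α_λ = λ⁻² α'₂ + λ⁻¹ α'₋₁ + α₀ + λ α''₁ + λ² α''₂`. -/
def extendedForm (α : ℂ → ℂ →L[ℝ] Aff ℝ) (l : ℂ) (z : ℂ) : ℂ →L[ℝ] Aff ℂ :=
  (l ^ 2)⁻¹ • dzPart (component α 2 z) + l⁻¹ • dzPart (component α (-1) z) + component α 0 z
    + l • dzbarPart (component α 1 z) + l ^ 2 • dzbarPart (component α 2 z)

/-! ### Conformal Lagrangian immersions and their lifts -/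

/-- `∂X/∂x`. -/
def dX (X : ℂ → Fin 4 → ℝ) (z : ℂ) : Fin 4 → ℝ := fderiv ℝ X z 1

/-- `∂X/∂y`. -/
def dY (X : ℂ → Fin 4 → ℝ) (z : ℂ) : Fin 4 → ℝ := fderiv ℝ X z Complex.I

/-- `X : Ω → ℝ⁴` is a smooth conformal Lagrangian immersion. -/
structure IsConformalLagrangianImmersion (Ω : Set ℂ) (X : ℂ → Fin 4 → ℝ) : Prop where
  smooth : ContDiffOn ℝ ∞ X Ω
  ne_zero : ∀ z ∈ Ω, dX X z ≠ 0
  norm_eq : ∀ z ∈ Ω, dX X z ⬝ᵥ dX X z = dY X z ⬝ᵥ dY X z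
  orthogonal : ∀ z ∈ Ω, dX X z ⬝ᵥ dY X z = 0
  lagrangian : ∀ z ∈ Ω, omega (dX X z) (dY X z) = 0

/-- `U = (F, X) : Ω → 𝒢 = U(2) ⋉ ℝ⁴` is a lifted conformal Lagrangian immersion (LCLI), with base
point `z₀`. Here `F z ε₁ = F z *ᵥ Pi.single 0 1` and `F z ε₃ = F z *ᵥ Pi.single 2 1`. -/
structure IsLCLI (Ω : Set ℂ) (z₀ : ℂ) (F : ℂ → Matrix (Fin 4) (Fin 4) ℝ) (X : ℂ → Fin 4 → ℝ) :
    Prop where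
  smooth : ContDiffOn ℝ ∞ (fun z i j => F z i j) Ω
  mem_rotGroup : ∀ z ∈ Ω, F z ∈ rotGroup
  base_rot : F z₀ = 1
  base_trans : X z₀ = 0
  immersion : IsConformalLagrangianImmersion Ω X
  angle : ∀ z ∈ Ω, lagAngle (dX X z) (dY X z)
    = lagAngle (F z *ᵥ Pi.single 0 1) (F z *ᵥ Pi.single 2 1)

/-- `α` is the Maurer-Cartan form `U⁻¹ dU = (F⁻¹ dF, F⁻¹ dX)` of `U = (F, X)` on `Ω`. -/
def IsMaurerCartanForm (Ω : Set ℂ) (α : ℂ → ℂ →L[ℝ] Aff ℝ)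
    (F : ℂ → Matrix (Fin 4) (Fin 4) ℝ) (X : ℂ → Fin 4 → ℝ) : Prop :=
  ∀ z ∈ Ω, ∀ v : ℂ,
    rot (α z v) = (F z)⁻¹ * Matrix.of (fderiv ℝ (fun w i j => F w i j) z v) ∧
      (α z v).2 = (F z)⁻¹ *ᵥ fderiv ℝ X z v

/-! ### Hamiltonian stationary immersions -/

/-- The density with respect to `dx dy` of the area element of the metric induced by `X`. -/
def areaDensity (X : ℂ → Fin 4 → ℝ) (z : ℂ) : ℝ :=
  Real.sqrt ((dX X z ⬝ᵥ dX X z) * (dY X z ⬝ᵥ dY X z) - (dX X z ⬝ᵥ dY X z) ^ 2)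

/-- `V` is a Hamiltonian variation of `X : Ω → ℝ⁴` with compact support in `Ω`: a compactly supported
smooth vector field along `X` with `X^* (ι_V ω) = dh` for some compactly supported smooth function
`h` on `Ω`. (If `H` is a function on `ℝ⁴`, then `V = (-J ∇H) ∘ X` satisfies this with
`h = H ∘ X`.) -/
def IsHamiltonianVariation (Ω : Set ℂ) (X V : ℂ → Fin 4 → ℝ) : Prop :=
  ContDiff ℝ ∞ V ∧ HasCompactSupport V ∧ tsupport V ⊆ Ω ∧
    ∃ h : ℂ → ℝ, ContDiff ℝ ∞ h ∧ HasCompactSupport h ∧ tsupport h ⊆ Ω ∧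
      ∀ z ∈ Ω, ∀ v : ℂ, omega (V z) (fderiv ℝ X z v) = fderiv ℝ h z v

/-- The immersion `X` of `Ω` is Hamiltonian stationary: it is a critical point of the area for all
compactly supported Hamiltonian variations. (`X + t V` and `X` differ on the support of `V`
only, so the area is taken over this compact set.) -/
def IsHamiltonianStationary (Ω : Set ℂ) (X : ℂ → Fin 4 → ℝ) : Prop :=
  ∀ V : ℂ → Fin 4 → ℝ, IsHamiltonianVariation Ω X V →
    HasDerivAt (fun t : ℝ => ∫ z in tsupport V, areaDensity (fun w => X w + t • V w) z) 0 0

end HamStat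

end

/-! Write `α = (η, t)` with `η = a L_i + b¹R_i + b²R_j + b³R_k`, and let subscripts `x`, `y` denote
values on `1` and `i`. Since `L_j` anticommutes with `L_i` and commutes with right multiplications,
`τ` has the `R`'s in degree 0, `L_i` in degree 2 and the translations in degrees ±1. The theorem
reduces to two real equations for `α`.

Part 1: after removing the isometry `F`, conformality, the Lagrangian condition and equality of
angles together say `t_y = L_j t_x`. Indeed `dz¹ ∧ dz²` takes on `(t_x, t_y)` a value of modulus
`|t_x|²` and argument 0, with real part `⟨L_j t_x, t_y⟩`, so Cauchy-Schwarz is an equality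
(`lagAngle_mulVec_iff`). Each of `α''₋₁ = 0` and `α'₁ = 0` is this same equation, and the
nonvanishing conditions then mean `t_x ≠ 0`. Flatness is necessary by symmetry of second
derivatives; it is sufficient because a flat connection on a simply connected domain has a parallel
frame (`exists_isParallelAt`), which stays in the group since `F Fᵀ` and `F L_i Fᵀ` are constant.

Part 2: in the curvature of `α_λ` the terms of order `λ^{±3}` vanish because `dz ∧ dz = 0`, and the
`R` and translation components vanish by flatness of `α`. What remains is the `L_i` component, which
is `λ⁻² - λ²` times the divergence of `a`, up to a nonzero constant (`curvature_extendLinear`). So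
all `α_λ` are flat iff `a` is coclosed. On the geometric side `ΔX = 2 L_i (a_x X_x + a_y X_y)`
(`IsLCLI.laplacian_eq`), so a variation with Hamiltonian `h` changes the area at rate `-2 ∫ h div a`
(`IsLCLI.integral_eq`). Every test function is the Hamiltonian of some normal field, so stationarity
is also `div a = 0`. -/

noncomputable section

namespace HamStat

/-! ### Local parallel frames of a flat connection in a Banach algebra -/

section Integration

variable {E A : Type*} [NormedAddCommGroup E] [NormedSpace ℝ E]
  [NormedRing A] [NormedAlgebra ℝ A]

/-- `u` solves the equation of parallel transport for the connection form `η` along the segment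
from `z` to `z + w`. -/
def IsRadialTransport (η : E → E →L[ℝ] A) (z w : E) (u : ℝ → A) : Prop :=
  u 0 = 1 ∧ ∀ s ∈ Set.Icc (0 : ℝ) 1,
    HasDerivWithinAt u (u s * η (z + s • w) w) (Set.Icc 0 1) s

theorem add_smul_mem_ball {z w : E} {r : ℝ} (hw : ‖w‖ < r) {s : ℝ} (hs : s ∈ Set.Icc (0 : ℝ) 1) :
    z + s • w ∈ Metric.ball z r := by
  have : ‖s • w‖ ≤ ‖w‖ := by
    rw [norm_smul, Real.norm_of_nonneg hs.1]
    exact mul_le_of_le_one_left (norm_nonneg _) hs.2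
  simpa [dist_eq_norm] using this.trans_lt hw

theorem norm_connection_le {η : E → E →L[ℝ] A} {z w : E} {r M : ℝ}
    (hη : ∀ y ∈ Metric.ball z r, ‖η y‖ ≤ M) (hr : M * r ≤ 1 / 2) (hw : ‖w‖ < r) {y : E}
    (hy : y ∈ Metric.ball z r) : ‖η y w‖ ≤ 1 / 2 :=
  ((η y).le_opNorm w).trans <| (mul_le_mul (hη y hy) hw.le (norm_nonneg _)
    ((norm_nonneg _).trans (hη y hy))).trans hr

/-- With `M r ≤ 1/2` the linear equation has coefficient at most `1/2`. On the ball of radius `‖1‖`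
about `1` the speed is then at most `2‖1‖ · 1/2 = ‖1‖`, so a single Picard-Lindelöf step reaches
time 1. -/
theorem exists_isRadialTransport [CompleteSpace A] {η : E → E →L[ℝ] A} {z : E} {r M : ℝ}
    (hη : ∀ y ∈ Metric.ball z r, ‖η y‖ ≤ M) (hc : ContinuousOn η (Metric.ball z r))
    (hr : M * r ≤ 1 / 2) {w : E} (hw : ‖w‖ < r) : ∃ u, IsRadialTransport η z w u := by
  have hb (s : ℝ) (hs : s ∈ Set.Icc (0 : ℝ) 1) : ‖η (z + s • w) w‖ ≤ 1 / 2 :=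
    norm_connection_le hη hr hw (add_smul_mem_ball hw hs)
  have hPL : IsPicardLindelof (fun s u => u * η (z + s • w) w) (tmin := 0) (tmax := 1)
      ⟨0, by simp⟩ (1 : A) ‖(1 : A)‖₊ 0 ‖(1 : A)‖₊ (1 / 2) := by
    refine ⟨fun s hs => ?_, fun x _ => ?_, fun s hs x hx => ?_, by simp⟩
    · refine LipschitzOnWith.of_dist_le_mul fun x _ y _ => ?_
      rw [dist_eq_norm, dist_eq_norm, ← sub_mul]
      refine (norm_mul_le _ _).trans ?_
      rw [mul_comm]
      exact mul_le_mul_of_nonneg_right (by simpa using hb s hs) (norm_nonneg (x - y))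
    · have h1 : ContinuousOn (fun s : ℝ => η (z + s • w)) (Set.Icc 0 1) :=
        hc.comp (by fun_prop) fun s hs => add_smul_mem_ball hw hs
      exact continuousOn_const.mul (h1.clm_apply continuousOn_const)
    · have h1 : ‖x‖ ≤ ‖(1 : A)‖ + ‖(1 : A)‖ := by
        have := norm_le_norm_add_norm_sub' x (1 : A)
        have h2 : ‖x - 1‖ ≤ ‖(1 : A)‖ := by simpa [dist_eq_norm] using hx
        linarith
      refine (norm_mul_le _ _).trans ((mul_le_mul h1 (hb s hs) (norm_nonneg _)
        (by positivity)).trans ?_)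
      simp only [coe_nnnorm]
      linarith
  exact hPL.exists_eq_forall_mem_Icc_hasDerivWithinAt₀

theorem hasDerivWithinAt_Ici {F : Type*} [NormedAddCommGroup F] [NormedSpace ℝ F] {f : ℝ → F}
    {f' : F} {s : ℝ} (hs : s ∈ Set.Ico (0 : ℝ) 1)
    (h : HasDerivWithinAt f f' (Set.Icc 0 1) s) : HasDerivWithinAt f f' (Set.Ici s) s := by
  have h1 : Set.Icc s 1 ∈ nhdsWithin s (Set.Ici s) := Icc_mem_nhdsGE hs.2
  exact (h.mono (Set.Icc_subset_Icc_left hs.1)).mono_of_mem_nhdsWithin h1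

theorem IsRadialTransport.norm_le {η : E → E →L[ℝ] A} {z w : E} {r M : ℝ} {u : ℝ → A}
    (hu : IsRadialTransport η z w u) (hη : ∀ y ∈ Metric.ball z r, ‖η y‖ ≤ M)
    (hr : M * r ≤ 1 / 2) (hw : ‖w‖ < r) {s : ℝ} (hs : s ∈ Set.Icc (0 : ℝ) 1) :
    ‖u s‖ ≤ ‖(1 : A)‖ * Real.exp 1 := by
  have h := norm_le_gronwallBound_of_norm_deriv_right_le (f := u)
    (f' := fun s => u s * η (z + s • w) w) (δ := ‖(1 : A)‖) (K := 1) (ε := 0) (a := 0) (b := 1)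
    (fun s hs => (hu.2 s hs).continuousWithinAt)
    (fun s hs => hasDerivWithinAt_Ici hs (hu.2 s (Set.Ico_subset_Icc_self hs)))
    (by rw [hu.1]) (fun s hs => ?_) s hs
  · refine h.trans ?_
    rw [gronwallBound_ε0]
    gcongr
    linarith [hs.2]
  · have := norm_connection_le hη hr hw
      (add_smul_mem_ball (z := z) hw (Set.Ico_subset_Icc_self hs))
    calc ‖u s * η (z + s • w) w‖ ≤ ‖u s‖ * 1 :=
          (norm_mul_le _ _).trans (mul_le_mul_of_nonneg_left (by linarith) (norm_nonneg _))
      _ = 1 * ‖u s‖ + 0 := by ring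

/-- Mean value inequality on the segment, with the derivative compared to its value at the endpoint
`x`. -/
theorem norm_image_sub_sub_fderiv_le {F : Type*} [NormedAddCommGroup F] [NormedSpace ℝ F]
    {f : E → F} {z : E} {r M : ℝ} (hM : 0 ≤ M)
    (hd : ∀ y ∈ Metric.ball z r, DifferentiableAt ℝ f y)
    (hl : ∀ x ∈ Metric.ball z r, ∀ y ∈ Metric.ball z r,
      ‖fderiv ℝ f y - fderiv ℝ f x‖ ≤ M * ‖y - x‖) {x y : E}
    (hx : x ∈ Metric.ball z r) (hy : y ∈ Metric.ball z r) :
    ‖f y - f x - fderiv ℝ f x (y - x)‖ ≤ M * ‖y - x‖ ^ 2 := by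
  have hsub : segment ℝ x y ⊆ Metric.ball z r := (convex_ball z r).segment_subset hx hy
  have h := Convex.norm_image_sub_le_of_norm_hasFDerivWithin_le' (f := f) (C := M * ‖y - x‖)
    (s := segment ℝ x y) (f' := fderiv ℝ f) (φ := fderiv ℝ f x) (x := x) (y := y)
    (fun p hp => (hd p (hsub hp)).hasFDerivAt.hasFDerivWithinAt)
    (fun p hp => (hl x hx p (hsub hp)).trans
      (mul_le_mul_of_nonneg_left (by simpa using norm_sub_le_of_mem_segment hp) hM))
    (convex_segment x y) (left_mem_segment ℝ x y) (right_mem_segment ℝ x y)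
  exact h.trans (le_of_eq (by ring))

/-- The curvature of the connection form `η` vanishes at `z`. -/
def IsFlatAt (η : E → E →L[ℝ] A) (z : E) : Prop :=
  ∀ v w, fderiv ℝ η z v w - fderiv ℝ η z w v + (η z v * η z w - η z w * η z v) = 0

/-- If `u` is the transport along `w`, the candidate for the transport along `w + h` is `u (1 + s
η(h))`. The quantity bounded here is, up to the factor `u`, the error with which the candidate
solves its equation. Flatness cancels the terms of first order in `h`. The remaining Taylor
remainder, second derivative term and product contribute 1, 1 and 3 to the constant 5. -/
theorem norm_variation_defect_le {η : E → E →L[ℝ] A} {z : E} {r M : ℝ} (hM : 1 ≤ M)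
    (hη : ∀ y ∈ Metric.ball z r, ‖η y‖ ≤ M) (hr : M * r ≤ 1 / 2)
    (hd : ∀ y ∈ Metric.ball z r, DifferentiableAt ℝ η y)
    (hη' : ∀ y ∈ Metric.ball z r, ‖fderiv ℝ η y‖ ≤ M)
    (hl : ∀ x ∈ Metric.ball z r, ∀ y ∈ Metric.ball z r,
      ‖fderiv ℝ η y - fderiv ℝ η x‖ ≤ M * ‖y - x‖)
    (hf : ∀ y ∈ Metric.ball z r, IsFlatAt η y) {w h : E} (hw : ‖w‖ < r) (hwh : ‖w + h‖ < r)
    {s : ℝ} (hs : s ∈ Set.Icc (0 : ℝ) 1) :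
    ‖(1 + s • η (z + s • w) h) * η (z + s • (w + h)) (w + h)
      - η (z + s • w) w * (1 + s • η (z + s • w) h) - η (z + s • w) h
      - s • fderiv ℝ η (z + s • w) w h‖ ≤ 5 * M ^ 2 * ‖h‖ ^ 2 := by
  have hy := add_smul_mem_ball (z := z) hw hs
  have hy' := add_smul_mem_ball (z := z) hwh hs
  have hr1 : r ≤ 1 / 2 := by nlinarith [(norm_nonneg w).trans_lt hw]
  have hh : ‖h‖ ≤ 1 := by
    have : ‖h‖ ≤ ‖w + h‖ + ‖w‖ := by simpa using norm_sub_le (w + h) w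
    linarith
  have hk : z + s • (w + h) - (z + s • w) = s • h := by rw [smul_add]; abel
  have hks : ‖s • h‖ ≤ ‖h‖ := by
    rw [norm_smul, Real.norm_of_nonneg hs.1]
    exact mul_le_of_le_one_left (norm_nonneg _) hs.2
  have hT := norm_image_sub_sub_fderiv_le (by linarith) hd hl hy hy'
  have hflat := hf _ hy h w
  rw [hk] at hT
  have nη := hη _ hy
  have nD := hη' _ hy
  generalize η (z + s • (w + h)) = η₂ at *
  generalize fderiv ℝ η (z + s • w) = D at *
  generalize η (z + s • w) = η₁ at *
  set T := (η₂ - η₁ - D (s • h)) (w + h) with hTdef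
  have nh := norm_nonneg h
  have nT : ‖T‖ ≤ M * ‖h‖ ^ 2 := by
    refine (ContinuousLinearMap.le_opNorm _ _).trans ?_
    have h1 : ‖η₂ - η₁ - D (s • h)‖ ≤ M * ‖h‖ ^ 2 := hT.trans (by gcongr)
    calc _ ≤ M * ‖h‖ ^ 2 * 1 := mul_le_mul h1 (by linarith) (norm_nonneg _) (by positivity)
      _ = _ := by ring
  have nX : ‖η₁ h‖ ≤ M * ‖h‖ := (η₁.le_opNorm h).trans (by gcongr)
  have nDk (v : E) : ‖D (s • h) v‖ ≤ M * ‖h‖ * ‖v‖ := by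
    refine ((D (s • h)).le_opNorm v).trans ?_
    gcongr
    exact (D.le_opNorm _).trans (by gcongr)
  have hdiff : η₂ (w + h) - η₁ w = T + D (s • h) (w + h) + η₁ h := by
    simp only [hTdef, sub_apply, map_add]; abel
  have ndiff : ‖η₂ (w + h) - η₁ w‖ ≤ 3 * M * ‖h‖ := by
    rw [hdiff]
    refine (norm_add₃_le).trans ?_
    have h1 := nDk (w + h)
    have h2 : M * ‖h‖ * ‖w + h‖ ≤ M * ‖h‖ * 1 := by gcongr; linarith
    have h3 : M * ‖h‖ ^ 2 ≤ M * ‖h‖ := by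
      rw [sq]
      exact mul_le_mul_of_nonneg_left (mul_le_of_le_one_left nh hh) (by linarith)
    linarith
  have key : (1 + s • η₁ h) * η₂ (w + h) - η₁ w * (1 + s • η₁ h) - η₁ h - s • D w h
      = T + D (s • h) h + s • (η₁ h * (η₂ (w + h) - η₁ w)) := by
    -- Flatness enters here: it exchanges the two arguments of the derivative at the cost of a
    -- commutator.
    have h1 : D h w = D w h - (η₁ h * η₁ w - η₁ w * η₁ h) := by
      rw [eq_sub_iff_add_eq, ← sub_eq_zero, ← hflat]; abel
    have h2 : η₂ (w + h) = T + s • D h w + s • D h h + η₁ h + η₁ w := by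
      rw [← sub_eq_iff_eq_add, hdiff, map_smul, smul_apply, map_add, smul_add]
      abel
    have h3 : (1 + s • η₁ h) * η₂ (w + h) = η₂ (w + h) + s • (η₁ h * η₂ (w + h)) := by
      rw [add_mul, one_mul, smul_mul_assoc]
    rw [h3, mul_sub, mul_add, mul_one, mul_smul_comm, map_smul, smul_apply,
      smul_sub]
    nth_rewrite 1 [h2]
    rw [h1, smul_sub, smul_sub]
    abel
  rw [key]
  refine norm_add₃_le.trans ?_
  have h1 := nDk h
  have h2 : ‖s • (η₁ h * (η₂ (w + h) - η₁ w))‖ ≤ (M * ‖h‖) * (3 * M * ‖h‖) := by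
    rw [norm_smul, Real.norm_of_nonneg hs.1]
    refine (mul_le_of_le_one_left (norm_nonneg _) hs.2).trans ((norm_mul_le _ _).trans ?_)
    gcongr
  have h3 : M * ‖h‖ ^ 2 ≤ M ^ 2 * ‖h‖ ^ 2 := by
    gcongr
    nlinarith
  nlinarith

/-- Grönwall's inequality for `e = v - u (1 + s η(h))`, which starts at 0 and satisfies the equation
for `v` up to a quadratic error. At `s = 1` this says that the endpoint of radial transport is
differentiable in `w` with derivative `u η`. -/
theorem IsRadialTransport.norm_sub_le {η : E → E →L[ℝ] A} {z : E} {r M : ℝ} (hM : 1 ≤ M)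
    (hη : ∀ y ∈ Metric.ball z r, ‖η y‖ ≤ M) (hr : M * r ≤ 1 / 2)
    (hd : ∀ y ∈ Metric.ball z r, DifferentiableAt ℝ η y)
    (hη' : ∀ y ∈ Metric.ball z r, ‖fderiv ℝ η y‖ ≤ M)
    (hl : ∀ x ∈ Metric.ball z r, ∀ y ∈ Metric.ball z r,
      ‖fderiv ℝ η y - fderiv ℝ η x‖ ≤ M * ‖y - x‖)
    (hf : ∀ y ∈ Metric.ball z r, IsFlatAt η y) {w h : E} (hw : ‖w‖ < r) (hwh : ‖w + h‖ < r)
    {u v : ℝ → A} (hu : IsRadialTransport η z w u) (hv : IsRadialTransport η z (w + h) v) :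
    ‖v 1 - u 1 - u 1 * η (z + w) h‖ ≤
      ‖(1 : A)‖ * Real.exp 1 * (5 * M ^ 2 * ‖h‖ ^ 2) * (Real.exp 1 - 1) := by
  set e : ℝ → A := fun s => v s - u s * (1 + s • η (z + s • w) h) with he
  set e' : ℝ → A := fun s => v s * η (z + s • (w + h)) (w + h)
    - (u s * η (z + s • w) w * (1 + s • η (z + s • w) h)
      + u s * (η (z + s • w) h + s • fderiv ℝ η (z + s • w) w h)) with he'
  have hde (s : ℝ) (hs : s ∈ Set.Icc (0 : ℝ) 1) : HasDerivWithinAt e (e' s) (Set.Icc 0 1) s := by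
    have h1 : HasDerivAt (fun s : ℝ => z + s • w) w s := by
      simpa using ((hasDerivAt_id s).smul_const w).const_add z
    have h2 : HasDerivAt (fun s : ℝ => η (z + s • w)) (fderiv ℝ η (z + s • w) w) s :=
      (hd _ (add_smul_mem_ball hw hs)).hasFDerivAt.comp_hasDerivAt s h1
    have h3 : HasDerivAt (fun s : ℝ => η (z + s • w) h) (fderiv ℝ η (z + s • w) w h) s := by
      simpa using h2.clm_apply (hasDerivAt_const s h)
    have h4 : HasDerivAt (fun s : ℝ => 1 + s • η (z + s • w) h)
        (η (z + s • w) h + s • fderiv ℝ η (z + s • w) w h) s := by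
      convert! ((hasDerivAt_id s).smul h3).const_add 1 using 1
      simp [add_comm]
    exact (hv.2 s hs).sub ((hu.2 s hs).mul h4.hasDerivWithinAt)
  have hg := norm_le_gronwallBound_of_norm_deriv_right_le (f := e) (f' := e') (δ := 0) (K := 1)
    (ε := ‖(1 : A)‖ * Real.exp 1 * (5 * M ^ 2 * ‖h‖ ^ 2)) (a := 0) (b := 1)
    (fun s hs => (hde s hs).continuousWithinAt)
    (fun s hs => hasDerivWithinAt_Ici hs (hde s (Set.Ico_subset_Icc_self hs)))
    (by simp [he, hu.1, hv.1]) (fun s hs => ?_) 1 (by simp)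
  · rw [gronwallBound_of_K_ne_0 one_ne_zero] at hg
    have h1 : e 1 = v 1 - u 1 - u 1 * η (z + w) h := by
      simp [he, mul_add, sub_sub]
    rw [h1] at hg
    simpa using hg
  · have hs' := Set.Ico_subset_Icc_self hs
    have h1 := norm_variation_defect_le hM hη hr hd hη' hl hf hw hwh hs'
    have h2 := hu.norm_le hη hr hw hs'
    have h3 := norm_connection_le hη hr hwh (add_smul_mem_ball (z := z) hwh hs')
    have h4 : e' s = e s * η (z + s • (w + h)) (w + h)
        + u s * ((1 + s • η (z + s • w) h) * η (z + s • (w + h)) (w + h)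
          - η (z + s • w) w * (1 + s • η (z + s • w) h) - η (z + s • w) h
          - s • fderiv ℝ η (z + s • w) w h) := by
      simp only [he, he']
      noncomm_ring
    rw [h4]
    refine (norm_add_le _ _).trans (add_le_add ?_ ?_)
    · refine (norm_mul_le _ _).trans ?_
      rw [mul_comm]
      exact mul_le_mul_of_nonneg_right (by linarith) (norm_nonneg _)
    · exact (norm_mul_le _ _).trans (mul_le_mul h2 h1 (norm_nonneg _) (by positivity))

/-- `U` is parallel for the connection form `η` at `w`: `dU = U η`. -/
def IsParallelAt (η : E → E →L[ℝ] A) (U : E → A) (w : E) : Prop :=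
  HasFDerivAt U ((ContinuousLinearMap.mul ℝ A (U w)).comp (η w)) w

/-- The frame is the endpoint of radial transport from the centre; the quadratic estimate above is
its differentiability. It equals `1` at the centre and units form an open set, so it is invertible
nearby. -/
theorem exists_isParallelAt_ball [CompleteSpace A] {η : E → E →L[ℝ] A} {z : E}
    (hη : ContDiffAt ℝ 2 η z) (hf : ∀ᶠ y in nhds z, IsFlatAt η y) :
    ∃ r > 0, ∃ Φ : E → A, ∀ w ∈ Metric.ball z r, IsParallelAt η Φ w ∧ IsUnit (Φ w) := by
  obtain ⟨K, t, ht, hK⟩ :=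
    (hη.fderiv_right (m := 1) (by norm_num)).exists_lipschitzOnWith
  have hcη : ∀ᶠ y in nhds z, ‖η y‖ ≤ ‖η z‖ + 1 :=
    (hη.continuousAt.norm.eventually (gt_mem_nhds (lt_add_one _))).mono fun _ h => h.le
  have hcη' : ∀ᶠ y in nhds z, ‖fderiv ℝ η y‖ ≤ ‖fderiv ℝ η z‖ + 1 :=
    ((hη.fderiv_right (m := 1) (by norm_num)).continuousAt.norm.eventually
      (gt_mem_nhds (lt_add_one _))).mono fun _ h => h.le
  have hd : ∀ᶠ y in nhds z, DifferentiableAt ℝ η y :=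
    (hη.eventually (by simp)).mono fun y hy => hy.differentiableAt (by simp)
  obtain ⟨r₀, hr₀, hball⟩ := Metric.eventually_nhds_iff_ball.1
    ((((hcη.and hcη').and hd).and hf).and ht)
  set M := max (max (‖η z‖ + 1) (‖fderiv ℝ η z‖ + 1)) K with hM
  have hM1 : 1 ≤ M := by
    have : (1 : ℝ) ≤ ‖η z‖ + 1 := by linarith [norm_nonneg (η z)]
    exact this.trans ((le_max_left _ _).trans (le_max_left _ _))
  have hM0 : 0 < M := by linarith
  -- The second bound gives `M r ≤ 1/2`, as radial transport requires.
  set r := min r₀ (1 / (2 * M)) with hr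
  have hr0 : 0 < r := lt_min hr₀ (by positivity)
  have hMr : M * r ≤ 1 / 2 := by
    calc M * r ≤ M * (1 / (2 * M)) := by gcongr; exact min_le_right _ _
      _ = 1 / 2 := by field_simp
  have hsub : Metric.ball z r ⊆ Metric.ball z r₀ := Metric.ball_subset_ball (min_le_left _ _)
  have b1 : ∀ y ∈ Metric.ball z r, ‖η y‖ ≤ M := fun y hy =>
    (hball y (hsub hy)).1.1.1.1.trans ((le_max_left _ _).trans (le_max_left _ _))
  have b2 : ∀ y ∈ Metric.ball z r, ‖fderiv ℝ η y‖ ≤ M := fun y hy =>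
    (hball y (hsub hy)).1.1.1.2.trans ((le_max_right _ _).trans (le_max_left _ _))
  have b3 : ∀ y ∈ Metric.ball z r, DifferentiableAt ℝ η y := fun y hy =>
    (hball y (hsub hy)).1.1.2
  have b4 : ∀ y ∈ Metric.ball z r, IsFlatAt η y := fun y hy => (hball y (hsub hy)).1.2
  have b5 : ∀ x ∈ Metric.ball z r, ∀ y ∈ Metric.ball z r,
      ‖fderiv ℝ η y - fderiv ℝ η x‖ ≤ M * ‖y - x‖ := fun x hx y hy =>
    (hK.norm_sub_le (hball y (hsub hy)).2 (hball x (hsub hx)).2).trans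
      (mul_le_mul_of_nonneg_right (le_max_right _ _) (norm_nonneg _))
  have hex (w : E) : ∃ u, ‖w‖ < r → IsRadialTransport η z w u := by
    by_cases hw : ‖w‖ < r
    · obtain ⟨u, hu⟩ := exists_isRadialTransport b1
        (fun y hy => (b3 y hy).continuousAt.continuousWithinAt) hMr hw
      exact ⟨u, fun _ => hu⟩
    · exact ⟨0, fun h => absurd h hw⟩
  choose u hu using hex
  have hpar : ∀ w ∈ Metric.ball z r, IsParallelAt η (fun y => u (y - z) 1) w := by
    intro w hw
    have hwr : ‖w - z‖ < r := by simpa [dist_eq_norm] using hw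
    set L := (ContinuousLinearMap.mul ℝ A (u (w - z) 1)).comp (η w) with hL
    have hO : (fun y => u (y - z) 1 - u (w - z) 1 - L (y - w))
        =O[nhds w] fun y => ‖y - w‖ ^ 2 := by
      refine Asymptotics.IsBigO.of_bound
        (‖(1 : A)‖ * Real.exp 1 * (5 * M ^ 2) * (Real.exp 1 - 1)) ?_
      filter_upwards [Metric.isOpen_ball.mem_nhds hw] with y hy
      have hyr : ‖(w - z) + (y - w)‖ < r := by simpa [dist_eq_norm] using hy
      have h := IsRadialTransport.norm_sub_le hM1 b1 hMr b3 b2 b5 b4 hwr hyr (hu _ hwr) (hu _ hyr)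
      have e1 : w - z + (y - w) = y - z := by abel
      have e2 : z + (w - z) = w := by abel
      rw [e1, e2] at h
      refine h.trans (le_of_eq ?_)
      rw [norm_pow, norm_norm]
      ring
    have h0 := hO.hasFDerivAt (𝕜 := ℝ) (by norm_num)
    have h2 : HasFDerivAt (fun y => L (y - w)) L w := by
      simpa only [map_sub] using L.hasFDerivAt.sub_const (L w)
    have h1 := (h0.add h2).add_const
      (u (w - z) 1)
    unfold IsParallelAt
    convert! h1 using 1
    · ext y
      simp
    · ext y
      simp [hL]
  have hone : u (z - z) 1 = 1 := by
    have h0 : ‖z - z‖ < r := by simpa using hr0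
    have h := hu _ h0
    have hc : ∀ s ∈ Set.Icc (0 : ℝ) 1, u (z - z) s = u (z - z) 0 := by
      refine constant_of_has_deriv_right_zero (fun s hs => (h.2 s hs).continuousWithinAt) ?_
      intro s hs
      simpa using hasDerivWithinAt_Ici hs (h.2 s (Set.Ico_subset_Icc_self hs))
    rw [hc 1 (by simp), h.1]
  have hunit : ∀ᶠ y in nhds z, IsUnit (u (y - z) 1) := by
    have hcont := HasFDerivAt.continuousAt (f := fun y => u (y - z) 1) (𝕜 := ℝ)
      (hpar z (Metric.mem_ball_self hr0))
    have : {x : A | IsUnit x} ∈ nhds (u (z - z) 1) := by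
      rw [hone]
      exact Units.isOpen.mem_nhds isUnit_one
    exact hcont this
  obtain ⟨r₁, hr₁, h₁⟩ := Metric.eventually_nhds_iff_ball.1 hunit
  refine ⟨min r r₁, lt_min hr0 hr₁, fun y => u (y - z) 1, fun w hw => ⟨hpar w ?_, h₁ w ?_⟩⟩
  · exact Metric.ball_subset_ball (min_le_left _ _) hw
  · exact Metric.ball_subset_ball (min_le_right _ _) hw

end Integration

/-! ### Global parallel frames on simply connected domains -/

section GlobalIntegration

variable {E A : Type*} [NormedAddCommGroup E] [NormedSpace ℝ E]
  [NormedRing A] [NormedAlgebra ℝ A]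

/-- The derivative of `U V⁻¹` is `U η V⁻¹ - U V⁻¹ (V η) V⁻¹ = 0`: two parallel frames differ by a
constant left factor. -/
theorem IsParallelAt.mul_inverse_eq [CompleteSpace A] {η : E → E →L[ℝ] A} {s : Set E}
    (hs : IsOpen s) (hs' : IsPreconnected s) {U V : E → A} (hU : ∀ w ∈ s, IsParallelAt η U w)
    (hV : ∀ w ∈ s, IsParallelAt η V w) (hu : ∀ w ∈ s, IsUnit (V w)) {x y : E} (hx : x ∈ s)
    (hy : y ∈ s) : U x * Ring.inverse (V x) = U y * Ring.inverse (V y) := by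
  have hd : ∀ w ∈ s, HasFDerivAt (fun w => U w * Ring.inverse (V w)) (0 : E →L[ℝ] A) w := by
    intro w hw
    obtain ⟨c, hc⟩ := hu w hw
    have h1 := (hasFDerivAt_ringInverse (𝕜 := ℝ) c)
    rw [hc] at h1
    have h2 := HasFDerivAt.mul' (hU w hw) (h1.comp w (hV w hw))
    refine h2.congr_fderiv ?_
    ext v
    simp [← hc, mul_assoc]
  exact hs.is_const_of_fderiv_eq_zero hs'
    (fun w hw => (hd w hw).differentiableAt.differentiableWithinAt)
    (fun w hw => (hd w hw).fderiv) hx hy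

/-- A copy of a type, with the discrete topology. -/
@[ext] structure DiscreteCopy (A : Type*) where
  /-- The underlying element. -/
  val : A

instance (A : Type*) : TopologicalSpace (DiscreteCopy A) := ⊥

instance (A : Type*) : DiscreteTopology (DiscreteCopy A) := ⟨rfl⟩

/-- The covering space of germs of parallel maps, obtained by gluing the products of small balls
with discrete spaces. -/
def parallelCore [CompleteSpace A] (η : E → E →L[ℝ] A) (Ω : Set E) (r : Ω → ℝ) (hr : ∀ i, 0 < r i)
    (Φ : Ω → E → A)
    (hΦ : ∀ i : Ω, ∀ w ∈ Metric.ball (i : E) (r i), IsParallelAt η (Φ i) w ∧ IsUnit (Φ i w)) :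
    FiberBundleCore Ω Ω (DiscreteCopy A) where
  baseSet i := Subtype.val ⁻¹' Metric.ball (i : E) (r i)
  isOpen_baseSet i := Metric.isOpen_ball.preimage continuous_subtype_val
  indexAt x := x
  mem_baseSet_at x := Metric.mem_ball_self (hr x)
  -- A fibre coordinate `v` in chart `i` stands for the germ of `v Φᵢ`, whose coordinate in chart
  -- `j` is `v Φᵢ Φⱼ⁻¹`.
  coordChange i j x v := ⟨v.val * (Φ i x * Ring.inverse (Φ j x))⟩
  coordChange_self i x hx v := by
    rw [Ring.mul_inverse_cancel _ (hΦ i x hx).2, mul_one]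
  -- The intersection of two balls is convex, hence connected, so `Φᵢ Φⱼ⁻¹` is constant there and
  -- the change of chart is a fixed map of a discrete fibre.
  continuousOn_coordChange i j := by
    rintro ⟨x₀, v₀⟩ ⟨h₀, -⟩
    have h : ContinuousOn (fun p : Ω × DiscreteCopy A =>
        (⟨p.2.val * (Φ i x₀ * Ring.inverse (Φ j x₀))⟩ : DiscreteCopy A))
        ((Subtype.val ⁻¹' Metric.ball (i : E) (r i) ∩ Subtype.val ⁻¹' Metric.ball (j : E) (r j))
          ×ˢ Set.univ) :=
      ((continuous_of_discreteTopology (f := fun v : DiscreteCopy A =>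
        (⟨v.val * (Φ i x₀ * Ring.inverse (Φ j x₀))⟩ : DiscreteCopy A))).comp
          continuous_snd).continuousOn
    refine (h.congr ?_) ⟨x₀, v₀⟩ ⟨h₀, trivial⟩
    rintro ⟨x, v⟩ ⟨hx, -⟩
    refine DiscreteCopy.ext (congrArg (v.val * ·) ?_)
    exact IsParallelAt.mul_inverse_eq (η := η)
      (s := Metric.ball (i : E) (r i) ∩ Metric.ball (j : E) (r j))
      (Metric.isOpen_ball.inter Metric.isOpen_ball)
      ((convex_ball _ _).inter (convex_ball _ _)).isPreconnected
      (fun w hw => (hΦ i w hw.1).1) (fun w hw => (hΦ j w hw.2).1) (fun w hw => (hΦ j w hw.2).2)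
      hx h₀
  coordChange_comp i j k x hx v := by
    refine DiscreteCopy.ext ?_
    change v.val * _ * _ = v.val * _
    rw [mul_assoc, mul_assoc (Φ i x), ← mul_assoc (Ring.inverse _),
      Ring.inverse_mul_cancel _ (hΦ j x hx.1.2).2, one_mul]

/-- A flat connection on a simply connected domain has a parallel section. -/
theorem exists_isParallelAt [CompleteSpace A] {η : E → E →L[ℝ] A} {Ω : Set E} (hΩ : IsOpen Ω)
    (hΩs : IsSimplyConnected Ω) {z₀ : E} (hz₀ : z₀ ∈ Ω) (hη : ContDiffOn ℝ 2 η Ω)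
    (hf : ∀ z ∈ Ω, IsFlatAt η z) :
    ∃ U : E → A, U z₀ = 1 ∧ ∀ w ∈ Ω, IsParallelAt η U w := by
  classical
  have hloc (i : Ω) : ∃ r > 0, ∃ Φ : E → A, ∀ w ∈ Metric.ball (i : E) r,
      IsParallelAt η Φ w ∧ IsUnit (Φ w) :=
    exists_isParallelAt_ball ((hη i i.2).contDiffAt (hΩ.mem_nhds i.2))
      (Filter.eventually_of_mem (hΩ.mem_nhds i.2) hf)
  choose r hr Φ hΦ using hloc
  set Z := parallelCore η Ω r hr Φ hΦ with hZ
  -- The fibres are discrete, so the bundle is a covering. Simple connectedness lifts the identity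
  -- of `Ω` to a section, i.e. a coherent choice of germs; its starting value is chosen so that `U
  -- z₀ = 1`.
  have hcov : IsCoveringMap Z.proj := FiberBundle.isCoveringMap
  have := hΩs.simplyConnectedSpace
  have := hΩ.locallyPathConnectedSpace
  obtain ⟨σ, ⟨hσ₀, hσ⟩, -⟩ := hcov.existsUnique_continuousMap_lifts (ContinuousMap.id Ω)
    (⟨z₀, hz₀⟩ : Ω) ⟨⟨z₀, hz₀⟩, (⟨Ring.inverse (Φ ⟨z₀, hz₀⟩ z₀)⟩ : DiscreteCopy A)⟩ rfl
  have hσ' (x : Ω) : (σ x).1 = x := congrFun hσ x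
  let c : Ω → DiscreteCopy A := fun x => (σ x).2
  have hσe (x : Ω) : σ x = ⟨x, c x⟩ := Bundle.TotalSpace.ext (hσ' x) HEq.rfl
  let U : E → A := fun w => if hw : w ∈ Ω then (c ⟨w, hw⟩).val * Φ ⟨w, hw⟩ w else 0
  refine ⟨U, ?_, fun w hw => ?_⟩
  · have h1 : c ⟨z₀, hz₀⟩ = ⟨Ring.inverse (Φ ⟨z₀, hz₀⟩ z₀)⟩ := by
      simp only [c]
      rw [hσ₀]
    simp only [U, hz₀, dite_true, h1]
    exact Ring.inverse_mul_cancel _ (hΦ _ _ (Metric.mem_ball_self (hr _))).2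
  · set i : Ω := ⟨w, hw⟩ with hi
    have hcont : ContinuousAt (fun x : Ω => (Z.localTriv i (σ x)).2) i := by
      have h1 : ContinuousAt (Z.localTriv i) (σ i) := by
        refine (Z.localTriv i).continuousAt ?_
        rw [(Z.localTriv i).mem_source]
        change ((σ i).1 : E) ∈ Metric.ball (i : E) (r i)
        rw [hσ' i]
        exact Metric.mem_ball_self (hr i)
      exact continuous_snd.continuousAt.comp (h1.comp σ.continuous.continuousAt)
    -- A continuous map to a discrete fibre is locally constant. Hence near `w` the map `U` is a
    -- constant times the local frame `Φᵢ`.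
    have hev : ∀ᶠ x : Ω in nhds i, (Z.localTriv i (σ x)).2 = (Z.localTriv i (σ i)).2 :=
      Filter.Tendsto.eventually (p := fun v => v = (Z.localTriv i (σ i)).2) hcont
        (by rw [nhds_discrete]; exact Filter.eventually_pure.2 rfl)
    have hval (x : Ω) : (Z.localTriv i (σ x)).2.val
        = (c x).val * (Φ x x * Ring.inverse (Φ i x)) := by
      rw [hσe x]
      rfl
    have hev2 : ∀ᶠ y in nhds w, U y = (Z.localTriv i (σ i)).2.val * Φ i y := by
      have h1 := hev
      rw [nhds_subtype_eq_comap, Filter.eventually_comap] at h1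
      filter_upwards [h1, hΩ.mem_nhds hw, Metric.ball_mem_nhds w (hr i)] with y hy hyΩ hyb
      rw [← hy ⟨y, hyΩ⟩ rfl, hval]
      simp only [U, hyΩ, dite_true]
      rw [mul_assoc, mul_assoc, Ring.inverse_mul_cancel _ (hΦ i y hyb).2, mul_one]
    have hp := (hΦ i w (Metric.mem_ball_self (hr i))).1
    have hd : HasFDerivAt (fun y => (Z.localTriv i (σ i)).2.val * Φ i y) _ w :=
      HasFDerivAt.const_mul (𝕜 := ℝ) hp (Z.localTriv i (σ i)).2.val
    have hUw := hev2.self_of_nhds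
    unfold IsParallelAt
    refine (hd.congr_of_eventuallyEq hev2).congr_fderiv ?_
    ext v
    rw [hUw]
    simp [mul_assoc]

end GlobalIntegration

/-! ### Coordinates on the Lie algebra and the eigenspaces of `τ` -/

section LieAlgebra

variable {R : Type*} [CommRing R]

/-- The element of the (complexified) Lie algebra with the given coordinates. -/
def gMk (a b₁ b₂ b₃ : R) (t : Fin 4 → R) : Aff R :=
  (Matrix.of.symm (a • Li R + b₁ • Ri R + b₂ • Rj R + b₃ • Rk R), t)

theorem gMk_fst (a b₁ b₂ b₃ : R) (t : Fin 4 → R) : (gMk a b₁ b₂ b₃ t).1 =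
    ![![0, -a - b₁, -b₂, -b₃], ![a + b₁, 0, b₃, -b₂], ![b₂, -b₃, 0, b₁ - a],
      ![b₃, b₂, a - b₁, 0]] := by
  change Matrix.of.symm (a • Li R + b₁ • Ri R + b₂ • Rj R + b₃ • Rk R) = _
  ext i j
  fin_cases i <;> fin_cases j <;> simp [Li, Ri, Rj, Rk] <;> ring

theorem gMk_add (a b₁ b₂ b₃ a' b₁' b₂' b₃' : R) (t t' : Fin 4 → R) :
    gMk a b₁ b₂ b₃ t + gMk a' b₁' b₂' b₃' t'
      = gMk (a + a') (b₁ + b₁') (b₂ + b₂') (b₃ + b₃') (t + t') := by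
  refine Prod.ext ?_ rfl
  rw [Prod.fst_add, gMk_fst, gMk_fst, gMk_fst]
  ext i j
  fin_cases i <;> fin_cases j <;> simp <;> ring

theorem gMk_smul (c a b₁ b₂ b₃ : R) (t : Fin 4 → R) :
    c • gMk a b₁ b₂ b₃ t = gMk (c * a) (c * b₁) (c * b₂) (c * b₃) (c • t) := by
  refine Prod.ext ?_ rfl
  rw [Prod.smul_fst, gMk_fst, gMk_fst]
  ext i j
  fin_cases i <;> fin_cases j <;> simp <;> ring

theorem gMk_neg (a b₁ b₂ b₃ : R) (t : Fin 4 → R) :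
    -gMk a b₁ b₂ b₃ t = gMk (-a) (-b₁) (-b₂) (-b₃) (-t) := by
  rw [← neg_one_smul R (gMk a b₁ b₂ b₃ t), gMk_smul]
  simp

theorem gMk_sub (a b₁ b₂ b₃ a' b₁' b₂' b₃' : R) (t t' : Fin 4 → R) :
    gMk a b₁ b₂ b₃ t - gMk a' b₁' b₂' b₃' t'
      = gMk (a - a') (b₁ - b₁') (b₂ - b₂') (b₃ - b₃') (t - t') := by
  rw [sub_eq_add_neg, gMk_neg, gMk_add]
  simp only [sub_eq_add_neg]

theorem Lj_mulVec (t : Fin 4 → R) : Lj R *ᵥ t = ![-t 2, t 3, t 0, -t 1] := by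
  ext i
  fin_cases i <;> simp [Lj, Matrix.mulVec, dotProduct, Fin.sum_univ_four]

theorem Li_mulVec (t : Fin 4 → R) : Li R *ᵥ t = ![-t 1, t 0, -t 3, t 2] := by
  ext i
  fin_cases i <;> simp [Li, Matrix.mulVec, dotProduct, Fin.sum_univ_four]

set_option maxHeartbeats 1000000 in
-- `L_i` commutes with the right multiplications, while `[R_i, R_j] = -2 R_k` because right
-- multiplication reverses products. The rotation part is therefore `-2 b × b'`.
theorem bracket_gMk (a b₁ b₂ b₃ a' b₁' b₂' b₃' : R) (t t' : Fin 4 → R) :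
    bracket (gMk a b₁ b₂ b₃ t) (gMk a' b₁' b₂' b₃' t') =
      gMk 0 (-(2 * (b₂ * b₃' - b₃ * b₂'))) (-(2 * (b₃ * b₁' - b₁ * b₃')))
        (-(2 * (b₁ * b₂' - b₂ * b₁')))
        (fun i => (gMk a b₁ b₂ b₃ t).1 i ⬝ᵥ t' - (gMk a' b₁' b₂' b₃' t').1 i ⬝ᵥ t) := by
  refine Prod.ext ?_ rfl
  change Matrix.of.symm (rot _ * rot _ - rot _ * rot _) = _
  simp only [rot, gMk_fst]
  ext i j
  fin_cases i <;> fin_cases j <;>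
    simp <;> ring

theorem gMk_eq_zero_iff {K : Type*} [Field K] [CharZero K] (a b₁ b₂ b₃ : K) (t : Fin 4 → K) :
    gMk a b₁ b₂ b₃ t = 0 ↔ a = 0 ∧ b₁ = 0 ∧ b₂ = 0 ∧ b₃ = 0 ∧ t = 0 := by
  constructor
  · intro h
    have h1 : (gMk a b₁ b₂ b₃ t).1 = 0 := congrArg Prod.fst h
    have ht : t = 0 := congrArg Prod.snd h
    rw [gMk_fst] at h1
    have e1 : a + b₁ = 0 := by simpa using congrFun (congrFun h1 1) 0
    have e2 : a - b₁ = 0 := by simpa using congrFun (congrFun h1 3) 2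
    have e3 : b₂ = 0 := by simpa using congrFun (congrFun h1 2) 0
    have e4 : b₃ = 0 := by simpa using congrFun (congrFun h1 3) 0
    refine ⟨?_, ?_, e3, e4, ht⟩
    · linear_combination (1 / 2 : K) * e1 + (1 / 2 : K) * e2
    · linear_combination (1 / 2 : K) * e1 - (1 / 2 : K) * e2
  · rintro ⟨rfl, rfl, rfl, rfl, rfl⟩
    refine Prod.ext ?_ rfl
    rw [gMk_fst]
    ext i j
    fin_cases i <;> fin_cases j <;> simp

theorem mem_lieG_iff (ξ : Aff ℝ) :
    ξ ∈ lieG ↔ ∃ a b₁ b₂ b₃ : ℝ, ξ = gMk a b₁ b₂ b₃ ξ.2 := by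
  constructor
  · rintro ⟨a, b₁, b₂, b₃, h⟩
    exact ⟨a, b₁, b₂, b₃, Prod.ext h rfl⟩
  · rintro ⟨a, b₁, b₂, b₃, h⟩
    exact ⟨a, b₁, b₂, b₃, by rw [h]; rfl⟩

theorem complexify_gMk (a b₁ b₂ b₃ : ℝ) (t : Fin 4 → ℝ) :
    complexify (gMk a b₁ b₂ b₃ t) = gMk (a : ℂ) b₁ b₂ b₃ (fun i => (t i : ℂ)) := by
  refine Prod.ext ?_ rfl
  change (fun i j => ((gMk a b₁ b₂ b₃ t).1 i j : ℂ)) = _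
  rw [gMk_fst, gMk_fst]
  ext i j
  fin_cases i <;> fin_cases j <;> simp

/-- `L_j` commutes with the `R`'s and anticommutes with `L_i`, and `L_j² = -1`, so conjugation
changes the sign of `a` only. -/
theorem tau_gMk (a b₁ b₂ b₃ : ℂ) (t : Fin 4 → ℂ) :
    tau (gMk a b₁ b₂ b₃ t) = gMk (-a) b₁ b₂ b₃ (-(Lj ℂ *ᵥ t)) := by
  refine Prod.ext ?_ rfl
  change Matrix.of.symm (-(Lj ℂ * rot _ * Lj ℂ)) = _
  simp only [rot, gMk_fst]
  ext i j
  fin_cases i <;> fin_cases j <;>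
    simp [Lj] <;> ring

theorem proj_gMk (k : ℤ) (a b₁ b₂ b₃ : ℂ) (t : Fin 4 → ℂ) :
    proj k (gMk a b₁ b₂ b₃ t) = (1 / 4 : ℂ) • (gMk a b₁ b₂ b₃ t
      + Complex.I ^ (-k) • gMk (-a) b₁ b₂ b₃ (-(Lj ℂ *ᵥ t))
      + Complex.I ^ (-(k * 2)) • gMk a b₁ b₂ b₃ (-t)
      + Complex.I ^ (-(k * 3)) • gMk (-a) b₁ b₂ b₃ (Lj ℂ *ᵥ t)) := by
  have h2 : tau (tau (gMk a b₁ b₂ b₃ t)) = gMk a b₁ b₂ b₃ (-t) := tau_sq_apply _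
  simp only [proj, Finset.sum_range_succ, Finset.sum_range_zero, zero_add, LinearMap.smul_apply,
    LinearMap.add_apply, pow_succ, pow_zero, Module.End.mul_apply, Module.End.one_apply, one_mul,
    h2]
  rw [tau_gMk, tau_gMk]
  simp [Matrix.mulVec_neg]

theorem proj_neg_one_gMk (a b₁ b₂ b₃ : ℂ) (t : Fin 4 → ℂ) :
    proj (-1) (gMk a b₁ b₂ b₃ t)
      = gMk 0 0 0 0 ((1 / 2 : ℂ) • (t - Complex.I • (Lj ℂ *ᵥ t))) := by
  have e3 : Complex.I ^ (3 : ℤ) = -Complex.I := by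
    rw [show (3 : ℤ) = ((3 : ℕ) : ℤ) by rfl, zpow_natCast, Complex.I_pow_three]
  have e2 : Complex.I ^ (2 : ℤ) = -1 := by
    rw [show (2 : ℤ) = ((2 : ℕ) : ℤ) by rfl, zpow_natCast, Complex.I_sq]
  rw [proj_gMk]
  norm_num [e2, e3]
  simp only [gMk_smul, gMk_add, gMk_neg]
  congr 1 <;> first | ring1 | module

theorem proj_one_gMk (a b₁ b₂ b₃ : ℂ) (t : Fin 4 → ℂ) :
    proj 1 (gMk a b₁ b₂ b₃ t)
      = gMk 0 0 0 0 ((1 / 2 : ℂ) • (t + Complex.I • (Lj ℂ *ᵥ t))) := by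
  have e3 : Complex.I ^ (-3 : ℤ) = Complex.I := by
    rw [zpow_neg, show (3 : ℤ) = ((3 : ℕ) : ℤ) by rfl, zpow_natCast, Complex.I_pow_three]
    simp
  have e2 : Complex.I ^ (-2 : ℤ) = -1 := by
    rw [zpow_neg, show (2 : ℤ) = ((2 : ℕ) : ℤ) by rfl, zpow_natCast, Complex.I_sq]
    norm_num
  rw [proj_gMk]
  norm_num [e2, e3]
  simp only [gMk_smul, gMk_add, gMk_neg]
  congr 1 <;> first | ring1 | module

theorem proj_zero_gMk (a b₁ b₂ b₃ : ℂ) (t : Fin 4 → ℂ) :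
    proj 0 (gMk a b₁ b₂ b₃ t) = gMk 0 b₁ b₂ b₃ 0 := by
  rw [proj_gMk]
  norm_num
  simp only [gMk_smul, gMk_add]
  congr 1 <;> first | ring1 | module

theorem proj_two_gMk (a b₁ b₂ b₃ : ℂ) (t : Fin 4 → ℂ) :
    proj 2 (gMk a b₁ b₂ b₃ t) = gMk a 0 0 0 0 := by
  have e2 : Complex.I ^ (-2 : ℤ) = -1 := by
    rw [zpow_neg, show (2 : ℤ) = ((2 : ℕ) : ℤ) by rfl, zpow_natCast, Complex.I_sq]
    norm_num
  have e4 : Complex.I ^ (-4 : ℤ) = 1 := by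
    rw [show (-4 : ℤ) = -2 + -2 by rfl, zpow_add₀ Complex.I_ne_zero, e2]
    norm_num
  have e6 : Complex.I ^ (-6 : ℤ) = -1 := by
    rw [show (-6 : ℤ) = -4 + -2 by rfl, zpow_add₀ Complex.I_ne_zero, e4, e2, one_mul]
  rw [proj_gMk]
  norm_num [e2, e4, e6]
  simp only [gMk_smul, gMk_add, gMk_neg]
  congr 1 <;> first | ring1 | module

end LieAlgebra

/-! ### The conditions on `α₋₁` and `α₁` as real equations -/

section Components

theorem dzbarPart_eq_zero_iff (θ : ℂ →L[ℝ] Aff ℂ) :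
    dzbarPart θ = 0 ↔ θ 1 + Complex.I • θ Complex.I = 0 := by
  constructor
  · intro h
    have h1 : dzbarPart θ 1 = 0 := by rw [h]; rfl
    have h2 := congrArg ((2 : ℂ) • ·) h1
    simpa [dzbarPart, smul_smul, ← smul_add] using h2
  · intro h
    ext1 v
    simp only [dzbarPart, h]
    simp

theorem dzPart_eq_zero_iff (θ : ℂ →L[ℝ] Aff ℂ) :
    dzPart θ = 0 ↔ θ 1 - Complex.I • θ Complex.I = 0 := by
  constructor
  · intro h
    have h1 : dzPart θ 1 = 0 := by rw [h]; rfl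
    have h2 := congrArg ((2 : ℂ) • ·) h1
    simpa [dzPart, smul_smul, ← smul_sub] using h2
  · intro h
    ext1 v
    simp only [dzPart, h]
    simp

theorem proj_neg_one_complexify {ξ : Aff ℝ} (h : ξ ∈ lieG) :
    proj (-1) (complexify ξ) = gMk 0 0 0 0
      ![(1 / 2 : ℂ) * ((ξ.2 0 : ℂ) + Complex.I * (ξ.2 2 : ℂ)),
        (1 / 2 : ℂ) * ((ξ.2 1 : ℂ) - Complex.I * (ξ.2 3 : ℂ)),
        (1 / 2 : ℂ) * ((ξ.2 2 : ℂ) - Complex.I * (ξ.2 0 : ℂ)),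
        (1 / 2 : ℂ) * ((ξ.2 3 : ℂ) + Complex.I * (ξ.2 1 : ℂ))] := by
  obtain ⟨a, b₁, b₂, b₃, hξ⟩ := (mem_lieG_iff ξ).1 h
  generalize ξ.2 = t at *
  rw [hξ, complexify_gMk, proj_neg_one_gMk, Lj_mulVec]
  congr 1
  ext i
  fin_cases i <;> simp [Matrix.vecHead, Matrix.vecTail]

theorem proj_one_complexify {ξ : Aff ℝ} (h : ξ ∈ lieG) :
    proj 1 (complexify ξ) = gMk 0 0 0 0
      ![(1 / 2 : ℂ) * ((ξ.2 0 : ℂ) - Complex.I * (ξ.2 2 : ℂ)),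
        (1 / 2 : ℂ) * ((ξ.2 1 : ℂ) + Complex.I * (ξ.2 3 : ℂ)),
        (1 / 2 : ℂ) * ((ξ.2 2 : ℂ) + Complex.I * (ξ.2 0 : ℂ)),
        (1 / 2 : ℂ) * ((ξ.2 3 : ℂ) - Complex.I * (ξ.2 1 : ℂ))] := by
  obtain ⟨a, b₁, b₂, b₃, hξ⟩ := (mem_lieG_iff ξ).1 h
  generalize ξ.2 = t at *
  rw [hξ, complexify_gMk, proj_one_gMk, Lj_mulVec]
  congr 1
  ext i
  fin_cases i <;> simp [Matrix.vecHead, Matrix.vecTail] <;> ring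

variable {α : ℂ → ℂ →L[ℝ] Aff ℝ} {z : ℂ}

theorem component_apply (k : ℤ) (v : ℂ) : component α k z v = proj k (complexify (α z v)) := rfl

/-- Applying `1 - i L_j` to `t_x + i t_y` gives `(t_x + L_j t_y) + i (t_y - L_j t_x)`, and both
parts vanish iff `t_y = L_j t_x`. The conjugate computation gives the same equation for `α'₁`. -/
theorem dzbarPart_component_neg_one_eq_zero_iff (h : ∀ v, α z v ∈ lieG) :
    dzbarPart (component α (-1) z) = 0 ↔ (α z Complex.I).2 = Lj ℝ *ᵥ (α z 1).2 := by
  rw [dzbarPart_eq_zero_iff, component_apply, component_apply, proj_neg_one_complexify (h _),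
    proj_neg_one_complexify (h _), gMk_smul, gMk_add, gMk_eq_zero_iff]
  generalize (α z 1).2 = t
  generalize (α z Complex.I).2 = s
  rw [Lj_mulVec]
  simp only [funext_iff, Fin.forall_fin_succ, Complex.ext_iff]
  simp
  constructor
  · rintro ⟨⟨h1, h1'⟩, ⟨h2, h2'⟩, ⟨h3, h3'⟩, h4, h4'⟩
    refine ⟨?_, ?_, ?_, ?_⟩ <;> linarith
  · rintro ⟨h1, h2, h3, h4⟩
    simp [h1, h2, h3, h4]

theorem dzPart_component_one_eq_zero_iff (h : ∀ v, α z v ∈ lieG) :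
    dzPart (component α 1 z) = 0 ↔ (α z Complex.I).2 = Lj ℝ *ᵥ (α z 1).2 := by
  rw [dzPart_eq_zero_iff, component_apply, component_apply, proj_one_complexify (h _),
    proj_one_complexify (h _), gMk_smul, gMk_sub, gMk_eq_zero_iff]
  generalize (α z 1).2 = t
  generalize (α z Complex.I).2 = s
  rw [Lj_mulVec]
  simp only [funext_iff, Fin.forall_fin_succ, Complex.ext_iff]
  simp
  constructor
  · rintro ⟨⟨h1, h1'⟩, ⟨h2, h2'⟩, ⟨h3, h3'⟩, h4, h4'⟩
    refine ⟨?_, ?_, ?_, ?_⟩ <;> linarith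
  · rintro ⟨h1, h2, h3, h4⟩
    simp [h1, h2, h3, h4]

/-- When `t_y = L_j t_x`, the vector `t_x - i t_y` already lies in the eigenspace for `-i`, so the
projection fixes it; its real part is `t_x`. -/
theorem dzPart_component_neg_one_eq_zero_iff (h : ∀ v, α z v ∈ lieG)
    (ht : (α z Complex.I).2 = Lj ℝ *ᵥ (α z 1).2) :
    dzPart (component α (-1) z) = 0 ↔ (α z 1).2 = 0 := by
  rw [dzPart_eq_zero_iff, component_apply, component_apply, proj_neg_one_complexify (h _),
    proj_neg_one_complexify (h _), gMk_smul, gMk_sub, gMk_eq_zero_iff, ht]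
  generalize (α z 1).2 = t
  rw [Lj_mulVec]
  simp only [funext_iff, Fin.forall_fin_succ, Complex.ext_iff]
  simp
  constructor
  · rintro ⟨⟨h1, h1'⟩, ⟨h2, h2'⟩, ⟨h3, h3'⟩, h4, h4'⟩
    refine ⟨?_, ?_, ?_, ?_⟩ <;> linarith
  · rintro ⟨h1, h2, h3, h4⟩
    simp [h1, h2, h3, h4]

theorem dzbarPart_component_one_eq_zero_iff (h : ∀ v, α z v ∈ lieG)
    (ht : (α z Complex.I).2 = Lj ℝ *ᵥ (α z 1).2) :
    dzbarPart (component α 1 z) = 0 ↔ (α z 1).2 = 0 := by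
  rw [dzbarPart_eq_zero_iff, component_apply, component_apply, proj_one_complexify (h _),
    proj_one_complexify (h _), gMk_smul, gMk_add, gMk_eq_zero_iff, ht]
  generalize (α z 1).2 = t
  rw [Lj_mulVec]
  simp only [funext_iff, Fin.forall_fin_succ, Complex.ext_iff]
  simp
  constructor
  · rintro ⟨⟨h1, h1'⟩, ⟨h2, h2'⟩, ⟨h3, h3'⟩, h4, h4'⟩
    refine ⟨?_, ?_, ?_, ?_⟩ <;> linarith
  · rintro ⟨h1, h2, h3, h4⟩
    simp [h1, h2, h3, h4]

end Components

/-! ### The extended form in coordinates -/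

section Extended

/-- The pointwise linear map that sends a form to its extended form. -/
def extendLinear (l : ℂ) : (ℂ →L[ℝ] Aff ℝ) →ₗ[ℝ] (ℂ →L[ℝ] Aff ℂ) where
  toFun θ := extendedForm (fun _ => θ) l 0
  map_add' θ θ' := by
    ext1 v
    simp only [extendedForm, dzPart, dzbarPart, component, complexForm, _root_.add_apply,
      _root_.smul_apply, ContinuousLinearMap.comp_apply, ContinuousLinearMap.smulRight_apply,
      ContinuousLinearMap.comp_add]
    module
  map_smul' c θ := by
    ext1 v
    have hc (x : Aff ℂ) : c • x = (c : ℂ) • x := rfl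
    simp only [extendedForm, dzPart, dzbarPart, component, complexForm, _root_.add_apply,
      _root_.smul_apply, ContinuousLinearMap.comp_apply, ContinuousLinearMap.smulRight_apply,
      ContinuousLinearMap.comp_smul, RingHom.id_apply, hc]
    module

theorem fderiv_extendedForm {α : ℂ → ℂ →L[ℝ] Aff ℝ} {z : ℂ} (hα : DifferentiableAt ℝ α z)
    (l v : ℂ) : fderiv ℝ (extendedForm α l) z v = extendLinear l (fderiv ℝ α z v) := by
  have h := (LinearMap.toContinuousLinearMap (extendLinear l)).hasFDerivAt.comp z hα.hasFDerivAt
  have h2 : HasFDerivAt (extendedForm α l)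
      ((LinearMap.toContinuousLinearMap (extendLinear l)).comp (fderiv ℝ α z)) z := h
  rw [h2.fderiv]
  rfl

/-- The relation `t_y = L_j t_x` removes `α''₋₁` and `α'₁`, so `λ⁻¹` comes only with `dz` and `λ`
only with `dz̄` in the translation part. The `R` coefficients do not involve `λ`. -/
theorem extendLinear_apply {θ : ℂ →L[ℝ] Aff ℝ} {a b₁ b₂ b₃ a' b₁' b₂' b₃' : ℝ} {t : Fin 4 → ℝ}
    (h1 : θ 1 = gMk a b₁ b₂ b₃ t) (hI : θ Complex.I = gMk a' b₁' b₂' b₃' (Lj ℝ *ᵥ t)) (l v : ℂ) :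
    extendLinear l θ v = gMk (R := ℂ)
      ((1 / 2) * ((l ^ 2)⁻¹ * (a - Complex.I * a') * v
        + l ^ 2 * (a + Complex.I * a') * (starRingEnd ℂ) v))
      (v.re * b₁ + v.im * b₁') (v.re * b₂ + v.im * b₂') (v.re * b₃ + v.im * b₃')
      ![(1 / 2 : ℂ) * (l⁻¹ * v * ((t 0 : ℂ) + Complex.I * (t 2 : ℂ))
          + l * (starRingEnd ℂ) v * ((t 0 : ℂ) - Complex.I * (t 2 : ℂ))),
        (1 / 2 : ℂ) * (l⁻¹ * v * ((t 1 : ℂ) - Complex.I * (t 3 : ℂ))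
          + l * (starRingEnd ℂ) v * ((t 1 : ℂ) + Complex.I * (t 3 : ℂ))),
        (1 / 2 : ℂ) * (l⁻¹ * v * ((t 2 : ℂ) - Complex.I * (t 0 : ℂ))
          + l * (starRingEnd ℂ) v * ((t 2 : ℂ) + Complex.I * (t 0 : ℂ))),
        (1 / 2 : ℂ) * (l⁻¹ * v * ((t 3 : ℂ) + Complex.I * (t 1 : ℂ))
          + l * (starRingEnd ℂ) v * ((t 3 : ℂ) - Complex.I * (t 1 : ℂ)))] := by
  have hv : θ v = v.re • θ 1 + v.im • θ Complex.I := by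
    rw [← map_smul, ← map_smul, ← map_add]
    congr 1
    simp
  have hk (k : ℤ) (w : ℂ) : component (fun _ => θ) k 0 w = proj k (complexify (θ w)) := rfl
  change extendedForm (fun _ => θ) l 0 v = _
  simp only [extendedForm, dzPart, dzbarPart, _root_.add_apply, _root_.smul_apply,
    ContinuousLinearMap.smulRight_apply, hk, hv, h1, hI, gMk_smul, gMk_add, complexify_gMk,
    proj_two_gMk, proj_one_gMk, proj_neg_one_gMk, proj_zero_gMk, Lj_mulVec, gMk_sub]
  congr 1
  · simp
    ring
  · simp
  · simp
  · simp
  · ext i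
    have hI2 : Complex.I ^ 2 = -1 := Complex.I_sq
    fin_cases i <;> simp [Matrix.vecHead, Matrix.vecTail] <;> ring_nf <;> rw [hI2] <;> ring

end Extended

/-! ### Curvature of the extended form at a point -/

section ExtendedFlat

/-- The `Li`-coefficient of an element of the Lie algebra. -/
def liCoeff : Aff ℝ →L[ℝ] ℝ :=
  LinearMap.toContinuousLinearMap
    { toFun := fun ξ => (ξ.1 1 0 + ξ.1 3 2) / 2
      map_add' := by
        intro x y
        simp
        ring
      map_smul' := by
        intro c x
        simp
        ring }

theorem liCoeff_gMk (a b₁ b₂ b₃ : ℝ) (t : Fin 4 → ℝ) : liCoeff (gMk a b₁ b₂ b₃ t) = a := by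
  change ((gMk a b₁ b₂ b₃ t).1 1 0 + (gMk a b₁ b₂ b₃ t).1 3 2) / 2 = a
  rw [gMk_fst]
  simp

theorem complexify_bracket (ξ ζ : Aff ℝ) :
    complexify (bracket ξ ζ) = bracket (complexify ξ) (complexify ζ) := by
  refine Prod.ext ?_ ?_
  · ext i j
    simp [complexify, bracket, rot, Matrix.mul_apply, Fin.sum_univ_four]
  · ext i
    simp [complexify, bracket, rot, Matrix.mulVec, dotProduct, Fin.sum_univ_four]

theorem complexify_injective : Function.Injective complexify := by
  intro x y h
  refine Prod.ext ?_ ?_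
  · ext i j
    have := congrFun (congrFun (congrArg Prod.fst h) i) j
    simpa [complexify] using this
  · ext i
    have := congrFun (congrArg Prod.snd h) i
    simpa [complexify] using this

/-- The value on the pair `(1, i)` of `dθ + θ ∧ θ`, where `θ'` is the derivative of `θ`. -/
def curvature {R : Type*} [Ring R] (θ θx θy : ℂ → Aff R) : Aff R :=
  θx Complex.I - θy 1 + bracket (θ 1) (θ Complex.I)

theorem bracket_antisymm {R : Type*} [Ring R] (a b : Aff R) : bracket a b = -bracket b a := by
  refine Prod.ext ?_ ?_
  · ext i j
    simp [bracket]
  · simp [bracket]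

/-- Flatness of `α` contains `da = 0`. Hence the `L_i` component of the curvature is `(i/2)(λ⁻² -
λ²)` times the divergence of `a`. The `R` component is that of `α`. The translation component is a
combination, with coefficients `λ⁻¹` and `λ`, of the torsion equation of `α` projected to the two
eigenspaces. -/
theorem curvature_extendLinear {θ θx θy : ℂ →L[ℝ] Aff ℝ} (h : ∀ v, θ v ∈ lieG)
    (hx : ∀ v, θx v ∈ lieG) (hy : ∀ v, θy v ∈ lieG)
    (ht : (θ Complex.I).2 = Lj ℝ *ᵥ (θ 1).2) (htx : (θx Complex.I).2 = Lj ℝ *ᵥ (θx 1).2)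
    (hty : (θy Complex.I).2 = Lj ℝ *ᵥ (θy 1).2) (hc : curvature θ θx θy = 0)
    {l : ℂ} (hl : l ≠ 0) :
    curvature (extendLinear l θ) (extendLinear l θx) (extendLinear l θy) = 0 ↔
      ((l ^ 2)⁻¹ - l ^ 2) * (liCoeff (θx 1) + liCoeff (θy Complex.I) : ℝ) = 0 := by
  obtain ⟨a, b₁, b₂, b₃, h1⟩ := (mem_lieG_iff _).1 (h 1)
  obtain ⟨a', b₁', b₂', b₃', h2⟩ := (mem_lieG_iff _).1 (h Complex.I)
  obtain ⟨p, q₁, q₂, q₃, h3⟩ := (mem_lieG_iff _).1 (hx 1)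
  obtain ⟨p', q₁', q₂', q₃', h4⟩ := (mem_lieG_iff _).1 (hx Complex.I)
  obtain ⟨r, s₁, s₂, s₃, h5⟩ := (mem_lieG_iff _).1 (hy 1)
  obtain ⟨r', s₁', s₂', s₃', h6⟩ := (mem_lieG_iff _).1 (hy Complex.I)
  rw [ht] at h2
  rw [htx] at h4
  rw [hty] at h6
  have e3 : liCoeff (θx 1) = p := by rw [h3, liCoeff_gMk]
  have e6 : liCoeff (θy Complex.I) = r' := by rw [h6, liCoeff_gMk]
  unfold curvature
  rw [e3, e6, extendLinear_apply h1 h2, extendLinear_apply h1 h2, extendLinear_apply h3 h4,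
    extendLinear_apply h5 h6, gMk_sub, bracket_gMk, gMk_add, gMk_eq_zero_iff]
  unfold curvature at hc
  rw [h1, h2, h4, h5, gMk_sub, bracket_gMk, gMk_add, gMk_eq_zero_iff] at hc
  clear e3 e6 h1 h2 h3 h4 h5 h6 ht htx hty h hx hy
  generalize (θ 1).2 = t at *
  generalize (θx 1).2 = u at *
  generalize (θy 1).2 = w at *
  obtain ⟨c0, c1, c2, c3, c4⟩ := hc
  have d0 := congrFun c4 0
  have d1 := congrFun c4 1
  have d2 := congrFun c4 2
  have d3 := congrFun c4 3
  rw [Lj_mulVec] at d0 d1 d2 d3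
  rw [Lj_mulVec] at d0 d1 d2 d3
  simp [gMk_fst, dotProduct, Fin.sum_univ_four, Matrix.vecHead, Matrix.vecTail] at c0 d0 d1 d2 d3
  have hI : Complex.I ^ 2 = -1 := Complex.I_sq
  have hI3 : Complex.I ^ 3 = -Complex.I := Complex.I_pow_three
  have g0 : (p' : ℂ) - r = 0 := by exact_mod_cast c0
  constructor
  · rintro ⟨k0, -⟩
    simp at k0
    push_cast
    linear_combination (norm := (ring_nf; simp only [hI, hI3]; ring))
      (-2 * Complex.I) * k0 + ((l ^ 2)⁻¹ + l ^ 2) * Complex.I * g0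
  intro hd
  -- Mixed terms such as `λ⁻² α'₂` against `λ α''₁` drop to order `λ⁻¹` by this relation; the
  -- multiples of `m1` below account for them.
  have m1 : l * l⁻¹ = 1 := mul_inv_cancel₀ hl
  have m2 : (l ^ 2)⁻¹ = l⁻¹ ^ 2 := (inv_pow l 2).symm
  rw [m2] at hd ⊢
  generalize l⁻¹ = m at *
  refine ⟨?_, ?_, ?_, ?_, ?_⟩
  · simp
    push_cast at hd
    linear_combination (norm := (ring_nf; simp only [hI]; ring))
      (Complex.I / 2) * hd + (m ^ 2 + l ^ 2) / 2 * g0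
  · have := congrArg (fun x : ℝ => (x : ℂ)) c1
    push_cast at this
    simpa using this
  · have := congrArg (fun x : ℝ => (x : ℂ)) c2
    push_cast at this
    simpa using this
  · have := congrArg (fun x : ℝ => (x : ℂ)) c3
    push_cast at this
    simpa using this
  · have f0 := congrArg (fun x : ℝ => (x : ℂ)) d0
    have f1 := congrArg (fun x : ℝ => (x : ℂ)) d1
    have f2 := congrArg (fun x : ℝ => (x : ℂ)) d2
    have f3 := congrArg (fun x : ℝ => (x : ℂ)) d3
    push_cast at f0 f1 f2 f3
    clear hd g0 c0 c1 c2 c3 c4 d0 d1 d2 d3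
    ext i
    fin_cases i <;> simp [gMk_fst, dotProduct, Fin.sum_univ_four]
    · linear_combination (norm := (ring_nf; simp only [hI, hI3]; ring))
        (1 / 2 * m) * (f0 + Complex.I * f2) + (1 / 2 * l) * (f0 - Complex.I * f2)
        + (1 / 2 * Complex.I * (m * (a - Complex.I * a') * (t 1 + Complex.I * t 3)
          - l * (a + Complex.I * a') * (t 1 - Complex.I * t 3))) * m1
    · linear_combination (norm := (ring_nf; simp only [hI, hI3]; ring))
        (1 / 2 * m) * (f1 - Complex.I * f3) + (1 / 2 * l) * (f1 + Complex.I * f3)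
        + (-1 / 2 * Complex.I * (m * (a - Complex.I * a') * (t 0 - Complex.I * t 2)
          - l * (a + Complex.I * a') * (t 0 + Complex.I * t 2))) * m1
    · linear_combination (norm := (ring_nf; simp only [hI, hI3]; ring))
        (1 / 2 * m) * (f2 - Complex.I * f0) + (1 / 2 * l) * (f2 + Complex.I * f0)
        + (1 / 2 * Complex.I * (m * (a - Complex.I * a') * (t 3 - Complex.I * t 1)
          - l * (a + Complex.I * a') * (t 3 + Complex.I * t 1))) * m1
    · linear_combination (norm := (ring_nf; simp only [hI, hI3]; ring))
        (1 / 2 * m) * (f3 + Complex.I * f1) + (1 / 2 * l) * (f3 - Complex.I * f1)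
        + (-1 / 2 * Complex.I * (m * (a - Complex.I * a') * (t 2 + Complex.I * t 0)
          - l * (a + Complex.I * a') * (t 2 - Complex.I * t 0))) * m1

end ExtendedFlat

/-! ### Regularity and flatness from a parallel frame -/

section Parallel

variable {E A : Type*} [NormedAddCommGroup E] [NormedSpace ℝ E]
  [NormedRing A] [NormedAlgebra ℝ A]

/-- Bootstrap: `dU = U η` is `Cⁿ` as soon as `U` is. -/
theorem contDiffOn_of_isParallelAt {η : E → E →L[ℝ] A} {U : E → A} {Ω : Set E} (hΩ : IsOpen Ω)
    (hη : ContDiffOn ℝ ∞ η Ω) (hU : ∀ w ∈ Ω, IsParallelAt η U w) : ContDiffOn ℝ ∞ U Ω := by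
  have hd : DifferentiableOn ℝ U Ω := fun w hw => HasFDerivAt.differentiableAt
    (f' := (ContinuousLinearMap.mul ℝ A (U w)).comp (η w)) (hU w hw) |>.differentiableWithinAt
  refine contDiffOn_infty.2 fun n => ?_
  induction n with
  | zero => exact contDiffOn_zero.2 hd.continuousOn
  | succ n ih =>
    push_cast
    rw [contDiffOn_succ_iff_fderiv_of_isOpen hΩ]
    refine ⟨hd, by simp, ?_⟩
    have h1 : ContDiffOn ℝ n (fun w => (ContinuousLinearMap.mul ℝ A (U w)).comp (η w)) Ω :=
      ((ContinuousLinearMap.mul ℝ A).contDiff.comp_contDiffOn ih).clm_comp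
        (hη.of_le (by exact_mod_cast le_top))
    exact h1.congr fun w hw => HasFDerivAt.fderiv (hU w hw)

/-- Symmetry of the second derivative of `U` reads `U · (curvature) = 0`. -/
theorem isFlatAt_of_isParallelAt {η : E → E →L[ℝ] A} {U : E → A} {z : E}
    (hη : DifferentiableAt ℝ η z) (hU : ∀ᶠ w in nhds z, IsParallelAt η U w) (hz : IsUnit (U z)) :
    IsFlatAt η z := by
  intro v w
  have hUz : HasFDerivAt U ((ContinuousLinearMap.mul ℝ A (U z)).comp (η z)) z := hU.self_of_nhds
  have h1 : HasFDerivAt (fun w => (ContinuousLinearMap.mul ℝ A (U w)).comp (η w)) _ z :=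
    ((ContinuousLinearMap.mul ℝ A).hasFDerivAt.comp z hUz).clm_comp hη.hasFDerivAt
  have h2 := second_derivative_symmetric_of_eventually hU h1 v w
  simp at h2
  refine hz.mul_left_cancel ?_
  rw [mul_zero]
  linear_combination (norm := noncomm_ring) h2

end Parallel

/-! ### From affine frames of `ℝ⁴` to parallel operators on `ℝ⁵` -/

section Frame

/-- The embedding of infinitesimal affine transformations of `ℝ⁴` in the linear ones of `ℝ⁵`. -/
def affineOp : Aff ℝ →L[ℝ] ((Fin 4 → ℝ) × ℝ →L[ℝ] (Fin 4 → ℝ) × ℝ) :=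
  LinearMap.toContinuousLinearMap
    { toFun := fun ξ => LinearMap.toContinuousLinearMap
        { toFun := fun p => (rot ξ *ᵥ p.1 + p.2 • ξ.2, 0)
          map_add' := by
            intro p q
            simp [Matrix.mulVec_add, add_smul]
            abel
          map_smul' := by
            intro c p
            simp [Matrix.mulVec_smul, mul_smul] }
      map_add' := by
        intro x y
        have h : rot (x + y) = rot x + rot y := rfl
        refine ContinuousLinearMap.ext fun p => Prod.ext ?_ ?_
        · simp [h, Matrix.add_mulVec]
          abel
        · simp
      map_smul' := by
        intro c x
        have h : rot (c • x) = c • rot x := rfl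
        refine ContinuousLinearMap.ext fun p => Prod.ext ?_ ?_
        · simp [h, Matrix.smul_mulVec, smul_comm p.2 c]
        · simp }

/-- The affine transformation of `ℝ⁴` induced by an operator on `ℝ⁵`. -/
def affinePart : ((Fin 4 → ℝ) × ℝ →L[ℝ] (Fin 4 → ℝ) × ℝ) →L[ℝ] Aff ℝ :=
  LinearMap.toContinuousLinearMap
    { toFun := fun U => (fun i j => (U (Pi.single j 1, 0)).1 i, (U (0, 1)).1)
      map_add' := by
        intro x y
        rfl
      map_smul' := by
        intro c x
        rfl }

theorem affineOp_apply (ξ : Aff ℝ) (p : (Fin 4 → ℝ) × ℝ) :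
    affineOp ξ p = (rot ξ *ᵥ p.1 + p.2 • ξ.2, 0) := rfl

theorem affinePart_apply (U : (Fin 4 → ℝ) × ℝ →L[ℝ] (Fin 4 → ℝ) × ℝ) : affinePart U =
    (fun i j => (U (Pi.single j 1, 0)).1 i, (U (0, 1)).1) := rfl

/-- The affine bracket becomes a commutator of operators, so the results for Banach algebras apply
to `α`. -/
theorem affineOp_bracket (ξ ζ : Aff ℝ) : affineOp (bracket ξ ζ)
    = affineOp ξ * affineOp ζ - affineOp ζ * affineOp ξ := by
  have h : rot (bracket ξ ζ) = rot ξ * rot ζ - rot ζ * rot ξ := rfl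
  have h' : (bracket ξ ζ).2 = rot ξ *ᵥ ζ.2 - rot ζ *ᵥ ξ.2 := rfl
  refine ContinuousLinearMap.ext fun p => Prod.ext ?_ ?_
  · simp only [_root_.sub_apply, mul_apply_eq_comp, affineOp_apply, h, h',
      Matrix.sub_mulVec, Matrix.mulVec_add, Matrix.mulVec_mulVec, Matrix.mulVec_smul, smul_sub,
      Prod.fst_sub, zero_smul, add_zero]
    abel
  · simp [affineOp_apply]

theorem rot_affinePart_mulVec (U : (Fin 4 → ℝ) × ℝ →L[ℝ] (Fin 4 → ℝ) × ℝ) (x : Fin 4 → ℝ) :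
    rot (affinePart U) *ᵥ x = (U (x, 0)).1 := by
  have hx : ((x, 0) : (Fin 4 → ℝ) × ℝ) = ∑ j, x j • (Pi.single j 1, 0) := by
    refine Prod.ext ?_ ?_
    · rw [Prod.fst_sum]
      simp only [Prod.smul_fst]
      exact pi_eq_sum_univ' x
    · rw [Prod.snd_sum]
      simp
  rw [hx, map_sum, Prod.fst_sum]
  simp only [map_smul]
  ext i
  simp [-Prod.smul_mk, Matrix.mulVec, dotProduct, rot, affinePart_apply, mul_comm]

theorem affinePart_mul (U : (Fin 4 → ℝ) × ℝ →L[ℝ] (Fin 4 → ℝ) × ℝ) (ξ : Aff ℝ) :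
    affinePart (U * affineOp ξ) = (Matrix.of.symm (rot (affinePart U) * rot ξ),
      rot (affinePart U) *ᵥ ξ.2) := by
  refine Prod.ext ?_ ?_
  · ext i j
    change _ = (rot (affinePart U) * rot ξ) i j
    have : (rot (affinePart U) * rot ξ) i j
        = (rot (affinePart U) *ᵥ (rot ξ *ᵥ Pi.single j 1)) i := by
      rw [Matrix.mulVec_mulVec, Matrix.mulVec_single_one]
      rfl
    rw [this, rot_affinePart_mulVec]
    simp [affinePart_apply, affineOp_apply]
  · rw [rot_affinePart_mulVec]
    simp [affinePart_apply, affineOp_apply]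

theorem affinePart_affineOp (ξ : Aff ℝ) : affinePart (affineOp ξ) = ξ := by
  refine Prod.ext ?_ ?_
  · ext i j
    simp [affinePart_apply, affineOp_apply, rot]
  · simp [affinePart_apply, affineOp_apply]

/-- The Maurer-Cartan equation `dα + α ∧ α = 0` at `z`. -/
def IsFlatFormAt (α : ℂ → ℂ →L[ℝ] Aff ℝ) (z : ℂ) : Prop :=
  ∀ v w, fderiv ℝ α z v w - fderiv ℝ α z w v + bracket (α z v) (α z w) = 0

theorem fderiv_clm_comp {F G : Type*} [NormedAddCommGroup F] [NormedSpace ℝ F]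
    [NormedAddCommGroup G] [NormedSpace ℝ G] {α : ℂ → ℂ →L[ℝ] F} {z : ℂ} (L : F →L[ℝ] G)
    (hα : DifferentiableAt ℝ α z) (v w : ℂ) :
    fderiv ℝ (fun z => L.comp (α z)) z v w = L (fderiv ℝ α z v w) := by
  have h : HasFDerivAt (fun z => L.comp (α z)) _ z :=
    ((ContinuousLinearMap.compL ℝ ℂ F G L).hasFDerivAt).comp z hα.hasFDerivAt
  rw [h.fderiv]
  simp

/-- `affineOp` respects brackets and has the left inverse `affinePart`, so no curvature is lost. -/
theorem isFlatAt_affineOp_iff {α : ℂ → ℂ →L[ℝ] Aff ℝ} {z : ℂ}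
    (hα : DifferentiableAt ℝ α z) :
    IsFlatAt (fun z => affineOp.comp (α z)) z ↔ IsFlatFormAt α z := by
  refine forall_congr' fun v => forall_congr' fun w => ?_
  rw [fderiv_clm_comp _ hα, fderiv_clm_comp _ hα]
  simp only [ContinuousLinearMap.comp_apply]
  rw [← affineOp_bracket, ← map_sub, ← map_add]
  constructor
  · intro h
    have := congrArg affinePart h
    rwa [affinePart_affineOp, map_zero] at this
  · intro h
    exact (congrArg affineOp h).trans (map_zero _)

theorem isFlatOn_complexForm_iff {Ω : Set ℂ} (hΩ : IsOpen Ω) {α : ℂ → ℂ →L[ℝ] Aff ℝ}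
    (hα : ContDiffOn ℝ ∞ α Ω) :
    IsFlatOn Ω (complexForm α) ↔ ∀ z ∈ Ω, IsFlatFormAt α z := by
  refine forall_congr' fun z => forall_congr' fun hz => forall_congr' fun v =>
    forall_congr' fun w => ?_
  have hd : DifferentiableAt ℝ α z :=
    (hα.contDiffAt (hΩ.mem_nhds hz)).differentiableAt (by simp)
  have h (v w) : fderiv ℝ (complexForm α) z v w = complexify (fderiv ℝ α z v w) :=
    fderiv_clm_comp _ hd v w
  rw [h, h]
  change complexify _ - complexify _ + bracket (complexify _) (complexify _) = 0 ↔ _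
  rw [← complexify_bracket, ← map_sub, ← map_add]
  exact ⟨fun h => complexify_injective (h.trans (map_zero _).symm),
    fun h => (congrArg complexify h).trans (map_zero _)⟩

/-- The pair `(F, X)` satisfies `dF = F η` and `dX = F t` at `z`, where `α = (η, t)`. -/
def IsFrameAt (α : ℂ → ℂ →L[ℝ] Aff ℝ) (F : ℂ → Matrix (Fin 4) (Fin 4) ℝ) (X : ℂ → Fin 4 → ℝ)
    (z : ℂ) : Prop :=
  DifferentiableAt ℝ (fun w i j => F w i j) z ∧ DifferentiableAt ℝ X z ∧
    (∀ v, fderiv ℝ (fun w i j => F w i j) z v = Matrix.of.symm (F z * rot (α z v))) ∧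
    ∀ v, fderiv ℝ X z v = F z *ᵥ (α z v).2

theorem isFrameAt_of_isParallelAt {α : ℂ → ℂ →L[ℝ] Aff ℝ}
    {U : ℂ → ((Fin 4 → ℝ) × ℝ →L[ℝ] (Fin 4 → ℝ) × ℝ)} {z : ℂ}
    (hU : IsParallelAt (fun z => affineOp.comp (α z)) U z) :
    IsFrameAt α (fun z => rot (affinePart (U z))) (fun z => (affinePart (U z)).2) z := by
  have h : HasFDerivAt (fun z => affinePart (U z)) _ z := affinePart.hasFDerivAt.comp z hU
  have h1 : HasFDerivAt (fun z => (affinePart (U z)).1) _ z := h.fst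
  have h2 : HasFDerivAt (fun z => (affinePart (U z)).2) _ z := h.snd
  refine ⟨h1.differentiableAt, h2.differentiableAt, fun v => ?_, fun v => ?_⟩
  · refine (DFunLike.congr_fun h1.fderiv v).trans ?_
    have := congrArg Prod.fst (affinePart_mul (U z) (α z v))
    exact this
  · refine (DFunLike.congr_fun h2.fderiv v).trans ?_
    have := congrArg Prod.snd (affinePart_mul (U z) (α z v))
    exact this

/-- The operator on `ℝ⁵` of the affine transformation with linear part `F` and translation part
`X`. -/
def frameOp (F : ℂ → Matrix (Fin 4) (Fin 4) ℝ) (X : ℂ → Fin 4 → ℝ) (z : ℂ) :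
    (Fin 4 → ℝ) × ℝ →L[ℝ] (Fin 4 → ℝ) × ℝ :=
  affineOp (Matrix.of.symm (F z), X z)
    + (ContinuousLinearMap.inr ℝ (Fin 4 → ℝ) ℝ).comp (ContinuousLinearMap.snd ℝ (Fin 4 → ℝ) ℝ)

theorem frameOp_apply (F : ℂ → Matrix (Fin 4) (Fin 4) ℝ) (X : ℂ → Fin 4 → ℝ) (z : ℂ)
    (p : (Fin 4 → ℝ) × ℝ) : frameOp F X z p = (F z *ᵥ p.1 + p.2 • X z, p.2) := by
  refine Prod.ext ?_ ?_
  · simp [frameOp, affineOp_apply, rot]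
  · simp [frameOp, affineOp_apply]

theorem isParallelAt_of_isFrameAt {α : ℂ → ℂ →L[ℝ] Aff ℝ} {F : ℂ → Matrix (Fin 4) (Fin 4) ℝ}
    {X : ℂ → Fin 4 → ℝ} {z : ℂ} (h : IsFrameAt α F X z) :
    IsParallelAt (fun z => affineOp.comp (α z)) (frameOp F X) z := by
  have h1 : HasFDerivAt (fun z => ((Matrix.of.symm (F z), X z) : Aff ℝ)) _ z :=
    h.1.hasFDerivAt.prodMk h.2.1.hasFDerivAt
  have h2 : HasFDerivAt (frameOp F X) _ z :=
    (affineOp.hasFDerivAt.comp z h1).add_const _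
  refine h2.congr_fderiv (ContinuousLinearMap.ext fun v => ?_)
  change affineOp (fderiv ℝ (fun w i j => F w i j) z v, fderiv ℝ X z v)
    = frameOp F X z * affineOp (α z v)
  rw [h.2.2.1 v, h.2.2.2 v]
  refine ContinuousLinearMap.ext fun p => Prod.ext ?_ ?_
  · simp [affineOp_apply, frameOp_apply, rot, Matrix.mulVec_add, Matrix.mulVec_smul]
  · simp [affineOp_apply, frameOp_apply]

theorem isUnit_frameOp {F : ℂ → Matrix (Fin 4) (Fin 4) ℝ} (X : ℂ → Fin 4 → ℝ) {z : ℂ}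
    (h : IsUnit (F z)) : IsUnit (frameOp F X z) := by
  have hd : IsUnit (F z).det := (Matrix.isUnit_iff_isUnit_det _).1 h
  -- The inverse of `x ↦ F x + X` is `x ↦ F⁻¹ x - F⁻¹ X`.
  refine ⟨⟨frameOp F X z, frameOp (fun z => (F z)⁻¹) (fun z => -((F z)⁻¹ *ᵥ X z)) z, ?_, ?_⟩, rfl⟩
  all_goals
    refine ContinuousLinearMap.ext fun p => Prod.ext ?_ ?_
    · simp [frameOp_apply, Matrix.mulVec_add, Matrix.mulVec_smul, Matrix.mulVec_neg,
        Matrix.mul_nonsing_inv _ hd, Matrix.nonsing_inv_mul _ hd]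
    · simp [frameOp_apply]

theorem isFlatFormAt_of_isFrameAt {α : ℂ → ℂ →L[ℝ] Aff ℝ} {F : ℂ → Matrix (Fin 4) (Fin 4) ℝ}
    {X : ℂ → Fin 4 → ℝ} {z : ℂ} (hα : DifferentiableAt ℝ α z)
    (h : ∀ᶠ w in nhds z, IsFrameAt α F X w) (hF : IsUnit (F z)) : IsFlatFormAt α z := by
  rw [← isFlatAt_affineOp_iff hα]
  refine isFlatAt_of_isParallelAt ?_ (h.mono fun w hw => isParallelAt_of_isFrameAt hw)
    (isUnit_frameOp X hF)
  exact (differentiableAt_const _).clm_comp hα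

theorem exists_isFrameAt {Ω : Set ℂ} (hΩ : IsOpen Ω) (hΩs : IsSimplyConnected Ω) {z₀ : ℂ}
    (hz₀ : z₀ ∈ Ω) {α : ℂ → ℂ →L[ℝ] Aff ℝ} (hα : ContDiffOn ℝ ∞ α Ω)
    (hf : ∀ z ∈ Ω, IsFlatFormAt α z) :
    ∃ (F : ℂ → Matrix (Fin 4) (Fin 4) ℝ) (X : ℂ → Fin 4 → ℝ),
      F z₀ = 1 ∧ X z₀ = 0 ∧ ContDiffOn ℝ ∞ (fun z i j => F z i j) Ω ∧ ContDiffOn ℝ ∞ X Ω ∧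
        ∀ z ∈ Ω, IsFrameAt α F X z := by
  have hη : ContDiffOn ℝ ∞ (fun z => affineOp.comp (α z)) Ω :=
    contDiffOn_const.clm_comp hα
  have h2 : (2 : WithTop ℕ∞) ≤ ∞ := WithTop.coe_le_coe.2 le_top
  obtain ⟨U, hU₀, hU⟩ := exists_isParallelAt hΩ hΩs hz₀ (hη.of_le h2)
    fun z hz => (isFlatAt_affineOp_iff
      ((hα.contDiffAt (hΩ.mem_nhds hz)).differentiableAt (by simp))).2 (hf z hz)
  have hs : ContDiffOn ℝ ∞ (fun z => affinePart (U z)) Ω :=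
    affinePart.contDiff.comp_contDiffOn (contDiffOn_of_isParallelAt hΩ hη hU)
  refine ⟨fun z => rot (affinePart (U z)), fun z => (affinePart (U z)).2, ?_, ?_,
    contDiff_fst.comp_contDiffOn hs, contDiff_snd.comp_contDiffOn hs,
    fun z hz => isFrameAt_of_isParallelAt (hU z hz)⟩
  · ext i j
    simp [hU₀, affinePart_apply, rot, Matrix.one_apply, Pi.single_apply]
  · ext i
    simp [hU₀, affinePart_apply]

/-- If `F` solves `dF = F η` and `η M + M ηᵀ = 0`, then `F M Fᵀ` is constant. -/
theorem mul_mul_transpose_eq {Ω : Set ℂ} (hΩ : IsOpen Ω) (hΩc : IsPreconnected Ω)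
    {α : ℂ → ℂ →L[ℝ] Aff ℝ} {F : ℂ → Matrix (Fin 4) (Fin 4) ℝ} {X : ℂ → Fin 4 → ℝ}
    (h : ∀ z ∈ Ω, IsFrameAt α F X z) {M : Matrix (Fin 4) (Fin 4) ℝ}
    (hM : ∀ z ∈ Ω, ∀ v, rot (α z v) * M + M * (rot (α z v))ᵀ = 0) {x y : ℂ} (hx : x ∈ Ω)
    (hy : y ∈ Ω) : F x * M * (F x)ᵀ = F y * M * (F y)ᵀ := by
  have hs (G H : Matrix (Fin 4) (Fin 4) ℝ) (i j : Fin 4) :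
      (G * M * Hᵀ) i j = ∑ l, ∑ k, G i k * M k l * H j l := by
    simp [Matrix.mul_apply, Finset.sum_mul]
  ext i j
  have hd : ∀ z ∈ Ω, HasFDerivAt (fun z => (F z * M * (F z)ᵀ) i j) (0 : ℂ →L[ℝ] ℝ) z := by
    intro z hz
    have he (i j : Fin 4) : HasFDerivAt (fun w => F w i j) _ z :=
      hasFDerivAt_pi'.1 (hasFDerivAt_pi'.1 (h z hz).1.hasFDerivAt i) j
    simp only [hs]
    refine (HasFDerivAt.fun_sum fun l _ => HasFDerivAt.fun_sum fun k _ =>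
      ((he i k).mul_const (M k l)).mul (he j l)).congr_fderiv (ContinuousLinearMap.ext fun v => ?_)
    have e (i j : Fin 4) : fderiv ℝ (fun w i j => F w i j) z v i j = (F z * rot (α z v)) i j :=
      congrFun (congrFun ((h z hz).2.2.1 v) i) j
    have e0 : F z * M * (F z * rot (α z v))ᵀ + F z * rot (α z v) * M * (F z)ᵀ = 0 := by
      rw [Matrix.transpose_mul]
      calc _ = F z * (rot (α z v) * M + M * (rot (α z v))ᵀ) * (F z)ᵀ := by noncomm_ring
        _ = 0 := by rw [hM z hz v]; simp
    have e1 := congrFun (congrFun e0 i) j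
    rw [Matrix.add_apply, hs, hs, ← Finset.sum_add_distrib] at e1
    simp only [← Finset.sum_add_distrib] at e1
    simp only [_root_.sum_apply, _root_.add_apply, _root_.smul_apply,
      ContinuousLinearMap.comp_apply, ContinuousLinearMap.proj_apply, e, smul_eq_mul,
      _root_.zero_apply]
    refine Eq.trans ?_ e1
    refine Finset.sum_congr rfl fun l _ => Finset.sum_congr rfl fun k _ => ?_
    ring
  exact hΩ.is_const_of_fderiv_eq_zero hΩc
    (fun w hw => (hd w hw).differentiableAt.differentiableWithinAt)
    (fun w hw => (hd w hw).fderiv) hx hy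

end Frame

/-! ### Bilinearity of the bracket -/

section Bilinear

theorem bracket_add_left {R : Type*} [Ring R] (a b c : Aff R) :
    bracket (a + b) c = bracket a c + bracket b c := by
  have h : rot (a + b) = rot a + rot b := rfl
  refine Prod.ext ?_ ?_
  · change rot (a + b) * rot c - rot c * rot (a + b)
      = rot a * rot c - rot c * rot a + (rot b * rot c - rot c * rot b)
    rw [h]
    noncomm_ring
  · change rot (a + b) *ᵥ c.2 - rot c *ᵥ (a.2 + b.2)
      = rot a *ᵥ c.2 - rot c *ᵥ a.2 + (rot b *ᵥ c.2 - rot c *ᵥ b.2)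
    rw [h, Matrix.add_mulVec, Matrix.mulVec_add]
    abel

theorem bracket_smul_left {R : Type*} [Ring R] [Algebra ℝ R] (r : ℝ) (a c : Aff R) : bracket (r • a) c = r • bracket a c := by
  have h : rot (r • a) = r • rot a := rfl
  refine Prod.ext ?_ ?_
  · change rot (r • a) * rot c - rot c * rot (r • a) = r • (rot a * rot c - rot c * rot a)
    rw [h, Matrix.smul_mul, Matrix.mul_smul, smul_sub]
  · change rot (r • a) *ᵥ c.2 - rot c *ᵥ (r • a.2) = r • (rot a *ᵥ c.2 - rot c *ᵥ a.2)
    rw [h, Matrix.smul_mulVec, Matrix.mulVec_smul, smul_sub]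

theorem bracket_self {R : Type*} [Ring R] (a : Aff R) : bracket a a = 0 := by
  refine Prod.ext ?_ ?_
  · ext i j
    simp [bracket]
  · simp [bracket]

theorem bracket_add_right {R : Type*} [Ring R] (a b c : Aff R) :
    bracket a (b + c) = bracket a b + bracket a c := by
  rw [bracket_antisymm, bracket_add_left, bracket_antisymm b, bracket_antisymm c]
  abel

theorem bracket_smul_right {R : Type*} [Ring R] [Algebra ℝ R] (r : ℝ) (a c : Aff R) : bracket a (r • c) = r • bracket a c := by
  rw [bracket_antisymm, bracket_smul_left, bracket_antisymm c, smul_neg, neg_neg]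

/-- A 2-form on the plane is determined by its value on the pair `(1, i)`. -/
theorem curvature_eq_zero_iff {R : Type*} [NormedRing R] [NormedAlgebra ℝ R] (θ : ℂ →L[ℝ] Aff R)
    (D : ℂ →L[ℝ] ℂ →L[ℝ] Aff R) :
    (∀ v w, D v w - D w v + bracket (θ v) (θ w) = 0)
      ↔ curvature θ (D 1) (D Complex.I) = 0 := by
  refine ⟨fun h => h 1 Complex.I, fun h v w => ?_⟩
  have e (v : ℂ) : v = v.re • (1 : ℂ) + v.im • Complex.I := by
    simp [Complex.re_add_im]
  have : D v w - D w v + bracket (θ v) (θ w)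
      = (v.re * w.im - v.im * w.re) • curvature θ (D 1) (D Complex.I) := by
    conv_lhs => rw [e v, e w]
    simp only [map_add, map_smul, _root_.add_apply, _root_.smul_apply, bracket_add_left,
      bracket_add_right, bracket_smul_left, bracket_smul_right, bracket_self, curvature]
    rw [bracket_antisymm (θ Complex.I) (θ 1)]
    module
  rw [this, h, smul_zero]

end Bilinear

/-! ### Flatness of all `α_λ` as coclosedness of `a` -/

section ExtendedFlat

/-- The linear projection onto the Lie algebra which keeps the translation component. -/
def lieProj : Aff ℝ →L[ℝ] Aff ℝ :=
  LinearMap.toContinuousLinearMap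
    { toFun := fun ξ => gMk ((ξ.1 1 0 + ξ.1 3 2) / 2) ((ξ.1 1 0 - ξ.1 3 2) / 2) (ξ.1 2 0) (ξ.1 3 0)
        ξ.2
      map_add' := by
        intro x y
        rw [gMk_add]
        simp only [Prod.fst_add, Prod.snd_add, Pi.add_apply]
        congr 1 <;> ring
      map_smul' := by
        intro c x
        rw [RingHom.id_apply, gMk_smul]
        simp only [Prod.smul_fst, Prod.smul_snd, Pi.smul_apply, smul_eq_mul]
        congr 1 <;> ring }

theorem lieProj_mem (ξ : Aff ℝ) : lieProj ξ ∈ lieG := ⟨_, _, _, _, rfl⟩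

theorem lieProj_eq {ξ : Aff ℝ} (h : ξ ∈ lieG) : lieProj ξ = ξ := by
  obtain ⟨a, b₁, b₂, b₃, h⟩ := (mem_lieG_iff ξ).1 h
  change gMk _ _ _ _ ξ.2 = ξ
  conv_rhs => rw [h]
  rw [h, gMk_fst]
  congr 1 <;> simp

variable {Ω : Set ℂ} {α : ℂ → ℂ →L[ℝ] Aff ℝ}

/-- Near `z` the form equals its composition with a linear projection onto `lieG`, so its
derivatives lie in the image of that projection. -/
theorem fderiv_mem_lieG {z : ℂ} (hα : DifferentiableAt ℝ α z)
    (h : ∀ᶠ w in nhds z, ∀ v, α w v ∈ lieG) (v w : ℂ) : fderiv ℝ α z v w ∈ lieG := by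
  have e : (fun z => lieProj.comp (α z)) =ᶠ[nhds z] α :=
    h.mono fun w hw => ContinuousLinearMap.ext fun v => lieProj_eq (hw v)
  rw [← e.fderiv_eq, fderiv_clm_comp _ hα]
  exact lieProj_mem _

theorem fderiv_snd_eq {z : ℂ} (hα : DifferentiableAt ℝ α z)
    (h : ∀ᶠ w in nhds z, (α w Complex.I).2 = Lj ℝ *ᵥ (α w 1).2) (v : ℂ) :
    (fderiv ℝ α z v Complex.I).2 = Lj ℝ *ᵥ (fderiv ℝ α z v 1).2 := by
  have h1 (u : ℂ) (i : Fin 4) : HasFDerivAt (fun w => (α w u).2 i) _ z :=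
    hasFDerivAt_pi'.1 (hα.hasFDerivAt.clm_apply (hasFDerivAt_const u z)).snd i
  have h2 (u : ℂ) (i : Fin 4) : fderiv ℝ (fun w => (α w u).2 i) z v = (fderiv ℝ α z v u).2 i := by
    rw [(h1 u i).fderiv]
    simp
  simp only [Lj_mulVec] at h ⊢
  have h3 (i : Fin 4) : (fun w => (α w Complex.I).2 i) =ᶠ[nhds z] fun w =>
      (![-(α w 1).2 2, (α w 1).2 3, (α w 1).2 0, -(α w 1).2 1] : Fin 4 → ℝ) i :=
    h.mono fun w hw => congrFun hw i
  ext i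
  rw [← h2, (h3 i).fderiv_eq]
  fin_cases i
  · simp [← h2, fderiv_fun_neg]
  · simp [← h2]
  · simp [← h2]
  · simp [← h2, fderiv_fun_neg]

/-- The extended form is flat for all `l` iff the 1-form `liCoeff ∘ α` is coclosed. -/
theorem forall_isFlatOn_extendedForm_iff (hΩ : IsOpen Ω) (hα : ContDiffOn ℝ ∞ α Ω)
    (hg : ∀ z ∈ Ω, ∀ v, α z v ∈ lieG) (ht : ∀ z ∈ Ω, (α z Complex.I).2 = Lj ℝ *ᵥ (α z 1).2)
    (hf : ∀ z ∈ Ω, IsFlatFormAt α z) :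
    (∀ l : ℂ, l ≠ 0 → IsFlatOn Ω (extendedForm α l)) ↔ ∀ z ∈ Ω,
      liCoeff (fderiv ℝ α z 1 1) + liCoeff (fderiv ℝ α z Complex.I Complex.I) = 0 := by
  have key : ∀ l : ℂ, l ≠ 0 → ∀ z ∈ Ω,
      ((∀ v w, fderiv ℝ (extendedForm α l) z v w - fderiv ℝ (extendedForm α l) z w v
        + bracket (extendedForm α l z v) (extendedForm α l z w) = 0) ↔
      ((l ^ 2)⁻¹ - l ^ 2) * (liCoeff (fderiv ℝ α z 1 1)
        + liCoeff (fderiv ℝ α z Complex.I Complex.I) : ℝ) = 0) := by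
    intro l hl z hz
    have hn : Ω ∈ nhds z := hΩ.mem_nhds hz
    have hd : DifferentiableAt ℝ α z := (hα.contDiffAt hn).differentiableAt (by simp)
    have hgz := Filter.eventually_of_mem hn hg
    have htz := Filter.eventually_of_mem hn ht
    rw [curvature_eq_zero_iff (extendedForm α l z) (fderiv ℝ (extendedForm α l) z), fderiv_extendedForm hd, fderiv_extendedForm hd]
    exact curvature_extendLinear (hg z hz) (fderiv_mem_lieG hd hgz 1)
      (fderiv_mem_lieG hd hgz Complex.I) (ht z hz) (fderiv_snd_eq hd htz 1)
      (fderiv_snd_eq hd htz Complex.I) (hf z hz 1 Complex.I) hl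
  constructor
  · intro h z hz
    -- One parameter suffices; any `λ` with `λ⁴ ≠ 1` would do, since only `λ⁻² - λ² ≠ 0` is needed.
    have := (key 2 two_ne_zero z hz).1 (h 2 two_ne_zero z hz)
    have h2 : ((2 : ℂ) ^ 2)⁻¹ - 2 ^ 2 ≠ 0 := by norm_num
    exact_mod_cast (mul_eq_zero.1 this).resolve_left h2
  · intro h l hl z hz
    refine (key l hl z hz).2 ?_
    rw [h z hz]
    simp

end ExtendedFlat

/-! ### The group `U(2)`, the complex volume and the Lagrangian angle -/

section RotationGroup

variable {F : Matrix (Fin 4) (Fin 4) ℝ}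

/-- Membership in the form `F M Fᵀ = M`, because `F M Fᵀ` is the expression conserved along a
solution of `dF = F η`. -/
theorem mem_rotGroup_iff : F ∈ rotGroup ↔ F * Fᵀ = 1 ∧ F * Li ℝ * Fᵀ = Li ℝ := by
  have e1 (x y : Fin 4 → ℝ) : (F *ᵥ x) ⬝ᵥ (F *ᵥ y) = x ⬝ᵥ ((Fᵀ * F) *ᵥ y) := by
    rw [← Matrix.mulVec_mulVec, Matrix.dotProduct_mulVec x, Matrix.vecMul_transpose]
  have hL : (Li ℝ)ᵀ = -Li ℝ := by
    ext i j
    fin_cases i <;> fin_cases j <;> simp [Li]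
  have e0 (G : Matrix (Fin 4) (Fin 4) ℝ) (x y : Fin 4 → ℝ) :
      (G *ᵥ x) ⬝ᵥ y = x ⬝ᵥ (Gᵀ *ᵥ y) := by
    rw [Matrix.dotProduct_mulVec x, Matrix.vecMul_transpose]
  have e2 (x y : Fin 4 → ℝ) : omega (F *ᵥ x) (F *ᵥ y) = x ⬝ᵥ ((-(Fᵀ * Li ℝ * F)) *ᵥ y) := by
    rw [omega, Matrix.mulVec_mulVec, e0, Matrix.mulVec_mulVec, Matrix.transpose_mul, hL]
    simp
  have e3 (x y : Fin 4 → ℝ) : omega x y = x ⬝ᵥ ((-Li ℝ) *ᵥ y) := by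
    rw [omega, e0, hL]
  have e4 (x y : Fin 4 → ℝ) : x ⬝ᵥ y = x ⬝ᵥ ((1 : Matrix (Fin 4) (Fin 4) ℝ) *ᵥ y) := by
    rw [Matrix.one_mulVec]
  have hext (A B : Matrix (Fin 4) (Fin 4) ℝ) : (∀ x y, x ⬝ᵥ (A *ᵥ y) = x ⬝ᵥ (B *ᵥ y)) ↔ A = B := by
    refine ⟨fun h => ?_, fun h x y => by rw [h]⟩
    ext i j
    simpa using h (Pi.single i 1) (Pi.single j 1)
  have h1 : (∀ x y, (F *ᵥ x) ⬝ᵥ (F *ᵥ y) = x ⬝ᵥ y) ↔ Fᵀ * F = 1 := by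
    rw [← hext]
    simp only [e1, ← e4]
  have h2 : (∀ x y, omega (F *ᵥ x) (F *ᵥ y) = omega x y) ↔ Fᵀ * Li ℝ * F = Li ℝ := by
    rw [← neg_inj, ← hext]
    simp only [e2, e3]
  rw [show F ∈ rotGroup ↔ _ from Iff.rfl, rotGroup, Set.mem_ofPred_eq, h1, h2]
  constructor
  · rintro ⟨h, h'⟩
    have hF := mul_eq_one_comm.1 h
    refine ⟨hF, ?_⟩
    calc F * Li ℝ * Fᵀ = F * (Fᵀ * Li ℝ * F) * Fᵀ := by rw [h']
      _ = (F * Fᵀ) * Li ℝ * (F * Fᵀ) := by noncomm_ring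
      _ = Li ℝ := by rw [hF]; simp
  · rintro ⟨h, h'⟩
    have hF := mul_eq_one_comm.1 h
    refine ⟨hF, ?_⟩
    calc Fᵀ * Li ℝ * F = Fᵀ * (F * Li ℝ * Fᵀ) * F := by rw [h']
      _ = (Fᵀ * F) * Li ℝ * (Fᵀ * F) := by noncomm_ring
      _ = Li ℝ := by rw [hF]; simp

theorem isUnit_of_mem_rotGroup (hF : F ∈ rotGroup) : IsUnit F :=
  IsUnit.of_mul_eq_one _ (mem_rotGroup_iff.1 hF).1

theorem mul_Li_of_mem_rotGroup (hF : F ∈ rotGroup) : F * Li ℝ = Li ℝ * F := by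
  obtain ⟨h, h'⟩ := mem_rotGroup_iff.1 hF
  calc F * Li ℝ = F * Li ℝ * (Fᵀ * F) := by rw [mul_eq_one_comm.1 h, mul_one]
    _ = (F * Li ℝ * Fᵀ) * F := by noncomm_ring
    _ = Li ℝ * F := by rw [h']

/-- A matrix commuting with `L_i` is complex linear, so it multiplies `dz¹ ∧ dz²` by its complex
determinant, the value on the image of `(ε₁, ε₃)`. -/
theorem complexVolume_mulVec (hF : F * Li ℝ = Li ℝ * F) (u v : Fin 4 → ℝ) :
    complexVolume (F *ᵥ u) (F *ᵥ v)
      = complexVolume (F *ᵥ Pi.single 0 1) (F *ᵥ Pi.single 2 1) * complexVolume u v := by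
  have e (i j : Fin 4) := congrFun (congrFun hF i) j
  have e00 : F 0 1 = -F 1 0 := by simpa [Li, Matrix.mul_apply, Fin.sum_univ_four] using e 0 0
  have e10 : F 1 1 = F 0 0 := by simpa [Li, Matrix.mul_apply, Fin.sum_univ_four] using e 1 0
  have e20 : F 2 1 = -F 3 0 := by simpa [Li, Matrix.mul_apply, Fin.sum_univ_four] using e 2 0
  have e30 : F 3 1 = F 2 0 := by simpa [Li, Matrix.mul_apply, Fin.sum_univ_four] using e 3 0
  have e02 : F 0 3 = -F 1 2 := by simpa [Li, Matrix.mul_apply, Fin.sum_univ_four] using e 0 2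
  have e12 : F 1 3 = F 0 2 := by simpa [Li, Matrix.mul_apply, Fin.sum_univ_four] using e 1 2
  have e22 : F 2 3 = -F 3 2 := by simpa [Li, Matrix.mul_apply, Fin.sum_univ_four] using e 2 2
  have e32 : F 3 3 = F 2 2 := by simpa [Li, Matrix.mul_apply, Fin.sum_univ_four] using e 3 2
  have hI : Complex.I ^ 2 = -1 := Complex.I_sq
  simp only [complexVolume, Matrix.mulVec_single_one, Matrix.col_apply]
  simp only [Matrix.mulVec, dotProduct, Fin.sum_univ_four, e00, e10, e20, e30, e02, e12, e22, e32]
  push_cast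
  have r1 (a b c d x0 x1 x2 x3 : ℂ) :
      a * x0 + -b * x1 + c * x2 + -d * x3 + Complex.I * (b * x0 + a * x1 + d * x2 + c * x3)
        = (a + Complex.I * b) * (x0 + Complex.I * x1)
          + (c + Complex.I * d) * (x2 + Complex.I * x3) := by
    linear_combination (b * x1 + d * x3) * (-hI)
  rw [r1, r1, r1, r1]
  ring

theorem complexVolume_eq (u v : Fin 4 → ℝ) : complexVolume u v =
    ⟨(Lj ℝ *ᵥ u) ⬝ᵥ v, u 0 * v 3 + u 1 * v 2 - v 0 * u 3 - v 1 * u 2⟩ := by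
  rw [Lj_mulVec]
  apply Complex.ext
  · simp [complexVolume, dotProduct, Fin.sum_univ_four]
    ring
  · simp [complexVolume]
    ring

/-- For Lagrangian planes this identifies `|dz¹ ∧ dz²|` with the Euclidean area of the
parallelogram. -/
theorem normSq_complexVolume (u v : Fin 4 → ℝ) : Complex.normSq (complexVolume u v)
    = (u ⬝ᵥ u) * (v ⬝ᵥ v) - (u ⬝ᵥ v) ^ 2 - omega u v ^ 2 := by
  rw [complexVolume_eq, Complex.normSq_mk, omega, Lj_mulVec, Li_mulVec]
  simp [dotProduct, Fin.sum_univ_four]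
  ring

theorem dotProduct_Lj_mulVec_self (u : Fin 4 → ℝ) : (Lj ℝ *ᵥ u) ⬝ᵥ (Lj ℝ *ᵥ u) = u ⬝ᵥ u := by
  rw [Lj_mulVec]
  simp [dotProduct, Fin.sum_univ_four]
  ring

theorem complexVolume_frame_ne_zero (hF : F ∈ rotGroup) :
    complexVolume (F *ᵥ Pi.single 0 1) (F *ᵥ Pi.single 2 1) ≠ 0 := by
  have h : omega (Pi.single 0 1) (Pi.single 2 1) = 0 := by
    rw [omega, Li_mulVec]
    simp
  rw [← Complex.normSq_pos, normSq_complexVolume, hF.1, hF.1, hF.1, hF.2, h]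
  simp

/-- The planes spanned by conformal bases with the Lagrangian angle of `F`. -/
theorem lagAngle_mulVec_iff (hF : F ∈ rotGroup) {u v : Fin 4 → ℝ} (hu : u ≠ 0) :
    (u ⬝ᵥ u = v ⬝ᵥ v ∧ u ⬝ᵥ v = 0 ∧ omega u v = 0 ∧ lagAngle (F *ᵥ u) (F *ᵥ v)
      = lagAngle (F *ᵥ Pi.single 0 1) (F *ᵥ Pi.single 2 1)) ↔ v = Lj ℝ *ᵥ u := by
  have hD := complexVolume_frame_ne_zero hF
  have hpos : 0 < u ⬝ᵥ u := lt_of_le_of_ne (Finset.sum_nonneg fun i _ => mul_self_nonneg _)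
    fun h => hu (dotProduct_self_eq_zero.1 h.symm)
  unfold lagAngle
  rw [complexVolume_mulVec (mul_Li_of_mem_rotGroup hF)]
  constructor
  · rintro ⟨h1, h2, h3, h4⟩
    have hn : Complex.normSq (complexVolume u v) = (u ⬝ᵥ u) ^ 2 := by
      rw [normSq_complexVolume, h2, h3, ← h1]
      ring
    have hc : complexVolume u v ≠ 0 := by
      rw [← Complex.normSq_pos, hn]
      positivity
    -- The determinant of `F` contributes the same angle to both sides and cancels, leaving a
    -- complex volume of argument 0.
    rw [Complex.arg_mul_coe_angle hD hc, add_eq_left, ← Real.Angle.coe_zero,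
      Real.Angle.angle_eq_iff_two_pi_dvd_sub] at h4
    have h5 : (complexVolume u v).arg = 0 := by
      refine Complex.arg_coe_angle_eq_iff.1 ?_ |>.trans Complex.arg_one
      rw [Complex.arg_one, Real.Angle.angle_eq_iff_two_pi_dvd_sub]
      exact h4
    obtain ⟨h6, h7⟩ := Complex.arg_eq_zero_iff.1 h5
    rw [Complex.normSq_apply, h7, mul_zero, add_zero] at hn
    have h8 : (Lj ℝ *ᵥ u) ⬝ᵥ v = u ⬝ᵥ u := by
      have : (complexVolume u v).re = (Lj ℝ *ᵥ u) ⬝ᵥ v := by rw [complexVolume_eq]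
      rw [← this]
      nlinarith
    -- Equality in Cauchy-Schwarz: `|v - L_j u|² = |v|² - 2⟨L_j u, v⟩ + |u|² = 0`.
    refine sub_eq_zero.1 (dotProduct_self_eq_zero.1 ?_)
    rw [sub_dotProduct, dotProduct_sub, dotProduct_sub, dotProduct_Lj_mulVec_self,
      dotProduct_comm v (Lj ℝ *ᵥ u), h8, ← h1]
    ring
  · rintro rfl
    refine ⟨(dotProduct_Lj_mulVec_self u).symm, ?_, ?_, ?_⟩
    · rw [Lj_mulVec]
      simp [dotProduct, Fin.sum_univ_four]
      ring
    · rw [omega, Lj_mulVec, Li_mulVec]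
      simp [dotProduct, Fin.sum_univ_four]
      ring
    · have : complexVolume u (Lj ℝ *ᵥ u) = ((u ⬝ᵥ u : ℝ) : ℂ) := by
        rw [complexVolume_eq, dotProduct_Lj_mulVec_self]
        apply Complex.ext
        · simp
        · rw [Lj_mulVec]
          simp
          ring
      rw [this, Complex.arg_mul_real hpos]

theorem rot_mem_lieG {ξ : Aff ℝ} (h : ξ ∈ lieG) : rot ξ + (rot ξ)ᵀ = 0 ∧
    rot ξ * Li ℝ + Li ℝ * (rot ξ)ᵀ = 0 := by
  obtain ⟨a, b₁, b₂, b₃, h⟩ := (mem_lieG_iff ξ).1 h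
  have h1 : rot ξ + (rot ξ)ᵀ = 0 := by
    rw [h]
    simp only [rot, gMk_fst]
    ext i j
    fin_cases i <;> fin_cases j <;> simp
  refine ⟨h1, ?_⟩
  rw [eq_neg_of_add_eq_zero_right h1, h]
  simp only [rot, gMk_fst]
  ext i j
  fin_cases i <;> fin_cases j <;> simp [Li]
  all_goals ring1

end RotationGroup

/-! ### Maurer-Cartan forms of LCLIs -/

section LCLI

variable {Ω : Set ℂ} {z₀ : ℂ} {α : ℂ → ℂ →L[ℝ] Aff ℝ} {F : ℂ → Matrix (Fin 4) (Fin 4) ℝ}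
  {X : ℂ → Fin 4 → ℝ}

theorem IsLCLI.isFrameAt (hΩ : IsOpen Ω) (h : IsLCLI Ω z₀ F X) (hm : IsMaurerCartanForm Ω α F X)
    {z : ℂ} (hz : z ∈ Ω) : IsFrameAt α F X z := by
  have hn : Ω ∈ nhds z := hΩ.mem_nhds hz
  have hd : IsUnit (F z).det :=
    (Matrix.isUnit_iff_isUnit_det _).1 (isUnit_of_mem_rotGroup (h.mem_rotGroup z hz))
  refine ⟨(h.smooth.contDiffAt hn).differentiableAt (by simp),
    (h.immersion.smooth.contDiffAt hn).differentiableAt (by simp), fun v => ?_, fun v => ?_⟩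
  · rw [(hm z hz v).1, Matrix.mul_nonsing_inv_cancel_left _ _ hd]
    rfl
  · rw [(hm z hz v).2, Matrix.mulVec_mulVec, Matrix.mul_nonsing_inv _ hd, Matrix.one_mulVec]

theorem IsFrameAt.dX_eq {z : ℂ} (h : IsFrameAt α F X z) : dX X z = F z *ᵥ (α z 1).2 := h.2.2.2 1

theorem IsFrameAt.dY_eq {z : ℂ} (h : IsFrameAt α F X z) :
    dY X z = F z *ᵥ (α z Complex.I).2 := h.2.2.2 Complex.I

theorem IsLCLI.snd_ne_zero (hΩ : IsOpen Ω) (h : IsLCLI Ω z₀ F X)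
    (hm : IsMaurerCartanForm Ω α F X) {z : ℂ} (hz : z ∈ Ω) : (α z 1).2 ≠ 0 := by
  intro h0
  refine h.immersion.ne_zero z hz ?_
  rw [(h.isFrameAt hΩ hm hz).dX_eq, h0, Matrix.mulVec_zero]

/-- `dX = F t` and `F` preserves both forms, so the conditions on `X` transfer to `t`. -/
theorem IsLCLI.snd_eq (hΩ : IsOpen Ω) (h : IsLCLI Ω z₀ F X) (hm : IsMaurerCartanForm Ω α F X)
    {z : ℂ} (hz : z ∈ Ω) : (α z Complex.I).2 = Lj ℝ *ᵥ (α z 1).2 := by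
  have hF := h.mem_rotGroup z hz
  have hf := h.isFrameAt hΩ hm hz
  have h1 := h.immersion.norm_eq z hz
  have h2 := h.immersion.orthogonal z hz
  have h3 := h.immersion.lagrangian z hz
  have h4 := h.angle z hz
  rw [hf.dX_eq, hf.dY_eq] at h1 h2 h3 h4
  rw [hF.1, hF.1] at h1
  rw [hF.1] at h2
  rw [hF.2] at h3
  exact (lagAngle_mulVec_iff hF (h.snd_ne_zero hΩ hm hz)).1 ⟨h1, h2, h3, h4⟩

theorem IsLCLI.isFlatFormAt (hΩ : IsOpen Ω) (hα : ContDiffOn ℝ ∞ α Ω) (h : IsLCLI Ω z₀ F X)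
    (hm : IsMaurerCartanForm Ω α F X) {z : ℂ} (hz : z ∈ Ω) : IsFlatFormAt α z := by
  have hn : Ω ∈ nhds z := hΩ.mem_nhds hz
  exact isFlatFormAt_of_isFrameAt ((hα.contDiffAt hn).differentiableAt (by simp))
    (Filter.eventually_of_mem hn fun w hw => h.isFrameAt hΩ hm hw)
    (isUnit_of_mem_rotGroup (h.mem_rotGroup z hz))

/-- `F M Fᵀ` keeps its initial value `M` for `M = 1` and `M = L_i`. -/
theorem mem_rotGroup_of_isFrameAt (hΩ : IsOpen Ω) (hΩc : IsPreconnected Ω) (hz₀ : z₀ ∈ Ω)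
    (hg : ∀ z ∈ Ω, ∀ v, α z v ∈ lieG) (h : ∀ z ∈ Ω, IsFrameAt α F X z) (h₀ : F z₀ = 1) {z : ℂ}
    (hz : z ∈ Ω) : F z ∈ rotGroup := by
  rw [mem_rotGroup_iff]
  constructor
  · have := mul_mul_transpose_eq hΩ hΩc h (M := 1) (fun z hz v => by
      simpa using (rot_mem_lieG (hg z hz v)).1) hz hz₀
    simpa [h₀] using this
  · have := mul_mul_transpose_eq hΩ hΩc h (M := Li ℝ)
      (fun z hz v => (rot_mem_lieG (hg z hz v)).2) hz hz₀
    simpa [h₀] using this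

theorem exists_isLCLI (hΩ : IsOpen Ω) (hΩs : IsSimplyConnected Ω) (hz₀ : z₀ ∈ Ω)
    (hα : ContDiffOn ℝ ∞ α Ω) (hg : ∀ z ∈ Ω, ∀ v, α z v ∈ lieG)
    (hf : ∀ z ∈ Ω, IsFlatFormAt α z) (ht : ∀ z ∈ Ω, (α z Complex.I).2 = Lj ℝ *ᵥ (α z 1).2)
    (hne : ∀ z ∈ Ω, (α z 1).2 ≠ 0) :
    ∃ (F : ℂ → Matrix (Fin 4) (Fin 4) ℝ) (X : ℂ → Fin 4 → ℝ),
      IsLCLI Ω z₀ F X ∧ IsMaurerCartanForm Ω α F X := by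
  obtain ⟨F, X, hF₀, hX₀, hFs, hXs, h⟩ := exists_isFrameAt hΩ hΩs hz₀ hα hf
  have hF {z : ℂ} (hz : z ∈ Ω) : F z ∈ rotGroup :=
    mem_rotGroup_of_isFrameAt hΩ hΩs.isPathConnected.isConnected.isPreconnected hz₀ hg h hF₀ hz
  have hd {z : ℂ} (hz : z ∈ Ω) : IsUnit (F z).det :=
    (Matrix.isUnit_iff_isUnit_det _).1 (isUnit_of_mem_rotGroup (hF hz))
  have hl (z : ℂ) (hz : z ∈ Ω) := (lagAngle_mulVec_iff (hF hz) (hne z hz)).2 (ht z hz)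
  refine ⟨F, X, ⟨hFs, fun z hz => hF hz, hF₀, hX₀, ⟨hXs, fun z hz h0 => hne z hz ?_,
    fun z hz => ?_, fun z hz => ?_, fun z hz => ?_⟩, fun z hz => ?_⟩, fun z hz v => ⟨?_, ?_⟩⟩
  · rw [(h z hz).dX_eq] at h0
    have := congrArg (fun x => (F z)⁻¹ *ᵥ x) h0
    simpa [Matrix.nonsing_inv_mul _ (hd hz)] using this
  · rw [(h z hz).dX_eq, (h z hz).dY_eq, (hF hz).1, (hF hz).1]
    exact (hl z hz).1
  · rw [(h z hz).dX_eq, (h z hz).dY_eq, (hF hz).1]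
    exact (hl z hz).2.1
  · rw [(h z hz).dX_eq, (h z hz).dY_eq, (hF hz).2]
    exact (hl z hz).2.2.1
  · rw [(h z hz).dX_eq, (h z hz).dY_eq]
    exact (hl z hz).2.2.2
  · rw [(h z hz).2.2.1 v]
    exact (Matrix.nonsing_inv_mul_cancel_left _ _ (hd hz)).symm
  · rw [(h z hz).2.2.2 v, Matrix.mulVec_mulVec, Matrix.nonsing_inv_mul _ (hd hz),
      Matrix.one_mulVec]

end LCLI

/-! ### Integration by parts and differentiation under the integral -/

section VariationOfIntegrals

open MeasureTheory Filter Topology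

variable {Ω K : Set ℂ}

/-- Outside `Ω` nothing is known about `f`, but the support of `g` stays inside `Ω`. -/
theorem continuous_mul_of_tsupport_subset (hΩ : IsOpen Ω) {f g : ℂ → ℝ} (hf : ContinuousOn f Ω)
    (hg : Continuous g) (hgΩ : tsupport g ⊆ Ω) : Continuous fun z => f z * g z := by
  refine continuous_of_tsupport fun z hz => ?_
  have hz' : z ∈ Ω := hgΩ (closure_mono (Function.support_mul_subset_right f g) hz)
  exact (hf.continuousAt (hΩ.mem_nhds hz')).mul hg.continuousAt

theorem integrable_mul_of_tsupport_subset (hΩ : IsOpen Ω) {f g : ℂ → ℝ} (hf : ContinuousOn f Ω)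
    (hg : Continuous g) (hgc : HasCompactSupport g) (hgΩ : tsupport g ⊆ Ω) :
    Integrable fun z => f z * g z :=
  (continuous_mul_of_tsupport_subset hΩ hf hg hgΩ).integrable_of_hasCompactSupport hgc.mul_left

/-- Integration by parts on an open set against a compactly supported function. -/
theorem integral_mul_fderiv_eq_neg (hΩ : IsOpen Ω) {f g : ℂ → ℝ} (hf : ContDiffOn ℝ ∞ f Ω)
    (hg : ContDiff ℝ ∞ g) (hgc : HasCompactSupport g) (hgΩ : tsupport g ⊆ Ω) (v : ℂ) :
    ∫ z, f z * fderiv ℝ g z v = -∫ z, fderiv ℝ f z v * g z := by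
  have h1 : Continuous fun z => fderiv ℝ g z v := by
    exact (hg.continuous_fderiv (by simp)).clm_apply continuous_const
  have h2 : ContinuousOn (fun z => fderiv ℝ f z v) Ω :=
    (hf.continuousOn_fderiv_of_isOpen hΩ (by simp)).clm_apply continuousOn_const
  refine integral_mul_fderiv_eq_neg_fderiv_mul_of_integrable
    (integrable_mul_of_tsupport_subset hΩ h2 hg.continuous hgc hgΩ)
    (integrable_mul_of_tsupport_subset hΩ hf.continuousOn h1 (hgc.fderiv_apply ℝ v)
      ((tsupport_fderiv_apply_subset ℝ v).trans hgΩ))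
    (integrable_mul_of_tsupport_subset hΩ hf.continuousOn hg.continuous hgc hgΩ)
    (fun x hx => (hf.contDiffAt (hΩ.mem_nhds (hgΩ hx))).differentiableAt (by simp))
    (fun x _ => hg.contDiffAt.differentiableAt (by simp))

/-- Differentiation under the integral sign of the square root of a positive function, over a
compact set. -/
theorem hasDerivAt_setIntegral_sqrt (hΩ : IsOpen Ω) (hK : IsCompact K) (hKΩ : K ⊆ Ω)
    {P P' : ℝ → ℂ → ℝ} (hP : ContinuousOn (Function.uncurry P) (Set.univ ×ˢ Ω))
    (hP' : ContinuousOn (Function.uncurry P') (Set.univ ×ˢ Ω))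
    (hd : ∀ z ∈ K, ∀ t, HasDerivAt (fun t => P t z) (P' t z) t) (h0 : ∀ z ∈ K, 0 < P 0 z) :
    HasDerivAt (fun t => ∫ z in K, √(P t z)) (∫ z in K, P' 0 z / (2 * √(P 0 z))) 0 := by
  have hn (z : ℂ) (hz : z ∈ K) : (Set.univ ×ˢ Ω : Set (ℝ × ℂ)) ∈ 𝓝 ((0 : ℝ), z) :=
    (isOpen_univ.prod hΩ).mem_nhds ⟨trivial, hKΩ hz⟩
  have hcP (z : ℂ) (hz : z ∈ K) := hP.continuousAt (hn z hz)
  have hcP' (z : ℂ) (hz : z ∈ K) := hP'.continuousAt (hn z hz)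
  have hsl {Q : ℝ → ℂ → ℝ} (hQ : ContinuousOn (Function.uncurry Q) (Set.univ ×ˢ Ω)) (t : ℝ) :
      ContinuousOn (Q t) K :=
    hQ.comp (f := fun z => (t, z)) (by fun_prop) fun z hz => ⟨trivial, hKΩ hz⟩
  -- Compactness of `K` makes positivity, and below the bound `C + 1` on the derivative, hold on all
  -- of `K` for one neighbourhood of `t = 0`; dominated convergence needs this uniformity.
  have hpos : ∀ᶠ t in 𝓝 (0 : ℝ), ∀ z ∈ K, 0 < P t z :=
    hK.eventually_forall_of_forall_eventually fun z hz =>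
      (hcP z hz).eventually (lt_mem_nhds (h0 z hz))
  have hc0 : ContinuousOn (fun z => P' 0 z / (2 * √(P 0 z))) K :=
    (hsl hP' 0).div (continuousOn_const.mul (hsl hP 0).sqrt) fun z hz => by
      have := Real.sqrt_pos.2 (h0 z hz)
      positivity
  obtain ⟨C, hC⟩ := hK.exists_bound_of_continuousOn hc0
  have hbd : ∀ᶠ t in 𝓝 (0 : ℝ), ∀ z ∈ K, ‖P' t z / (2 * √(P t z))‖ < C + 1 := by
    refine hK.eventually_forall_of_forall_eventually fun z hz => ?_
    have hs : 2 * √(P 0 z) ≠ 0 := by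
      have := Real.sqrt_pos.2 (h0 z hz)
      positivity
    have hc : ContinuousAt (fun p : ℝ × ℂ => ‖P' p.1 p.2 / (2 * √(P p.1 p.2))‖) (0, z) :=
      ((hcP' z hz).div (continuousAt_const.mul (hcP z hz).sqrt) hs).norm
    exact hc.eventually (gt_mem_nhds (lt_of_le_of_lt (hC z hz) (lt_add_one C)))
  have hfin : IsFiniteMeasure (volume.restrict K) := ⟨by simpa using hK.measure_lt_top⟩
  refine (hasDerivAt_integral_of_dominated_loc_of_deriv_le
    (F := fun t z => √(P t z)) (F' := fun t z => P' t z / (2 * √(P t z)))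
    (bound := fun _ => C + 1) (hpos.and hbd) ?_ ?_ ?_ ?_ ?_ ?_).2
  · exact Eventually.of_forall fun t => (hsl hP t).sqrt.aestronglyMeasurable hK.measurableSet
  · exact (hsl hP 0).sqrt.integrableOn_compact hK
  · exact hc0.aestronglyMeasurable hK.measurableSet
  · exact (ae_restrict_iff' hK.measurableSet).2 (Eventually.of_forall fun z hz t ht =>
      (ht.2 z hz).le)
  · exact integrable_const _
  · exact (ae_restrict_iff' hK.measurableSet).2 (Eventually.of_forall fun z hz t ht =>
      (hd z hz t).sqrt (ht.1 z hz).ne')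

end VariationOfIntegrals

/-! ### First variation of area -/

section AreaVariation

open MeasureTheory

theorem hasDerivAt_dotProduct_add_smul (A B C D : Fin 4 → ℝ) (t : ℝ) :
    HasDerivAt (fun t : ℝ => (A + t • C) ⬝ᵥ (B + t • D))
      (C ⬝ᵥ (B + t • D) + (A + t • C) ⬝ᵥ D) t := by
  simp only [dotProduct, ← Finset.sum_add_distrib]
  refine HasDerivAt.fun_sum fun i _ => ?_
  have h (x y : ℝ) : HasDerivAt (fun t : ℝ => x + t * y) y t := by
    simpa using ((hasDerivAt_id t).mul_const y).const_add x
  exact (h (A i) (C i)).mul (h (B i) (D i))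

variable {Ω : Set ℂ} {X V : ℂ → Fin 4 → ℝ}

theorem contDiffOn_dX (hΩ : IsOpen Ω) (hX : ContDiffOn ℝ ∞ X Ω) : ContDiffOn ℝ ∞ (dX X) Ω :=
  (hX.fderiv_of_isOpen hΩ (by simp)).clm_apply contDiffOn_const

theorem contDiffOn_dY (hΩ : IsOpen Ω) (hX : ContDiffOn ℝ ∞ X Ω) : ContDiffOn ℝ ∞ (dY X) Ω :=
  (hX.fderiv_of_isOpen hΩ (by simp)).clm_apply contDiffOn_const

theorem fderiv_add_const_smul {z : ℂ} (hX : DifferentiableAt ℝ X z) (hV : DifferentiableAt ℝ V z)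
    (t : ℝ) (v : ℂ) :
    fderiv ℝ (fun w => X w + t • V w) z v = fderiv ℝ X z v + t • fderiv ℝ V z v := by
  have h : HasFDerivAt (fun w => X w + t • V w) (fderiv ℝ X z + t • fderiv ℝ V z) z :=
    hX.hasFDerivAt.add (hV.hasFDerivAt.const_smul t)
  rw [h.fderiv]
  rfl

/-- The first variation of the area of a conformal immersion. -/
theorem hasDerivAt_area (hΩ : IsOpen Ω) (hX : IsConformalLagrangianImmersion Ω X)
    (hV : ContDiff ℝ ∞ V) (hVc : HasCompactSupport V) (hVΩ : tsupport V ⊆ Ω) :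
    HasDerivAt (fun t : ℝ => ∫ z in tsupport V, areaDensity (fun w => X w + t • V w) z)
      (∫ z, (dX X z ⬝ᵥ dX V z + dY X z ⬝ᵥ dY V z)) 0 := by
  have hXx := (contDiffOn_dX hΩ hX.smooth).continuousOn
  have hXy := (contDiffOn_dY hΩ hX.smooth).continuousOn
  have hVx := (contDiffOn_dX hΩ hV.contDiffOn).continuousOn
  have hVy := (contDiffOn_dY hΩ hV.contDiffOn).continuousOn
  let A : ℝ → ℂ → Fin 4 → ℝ := fun t z => dX X z + t • dX V z
  let B : ℝ → ℂ → Fin 4 → ℝ := fun t z => dY X z + t • dY V z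
  have hm : Set.MapsTo Prod.snd (Set.univ ×ˢ Ω : Set (ℝ × ℂ)) Ω := fun p hp => hp.2
  have hcA : ContinuousOn (Function.uncurry A) (Set.univ ×ˢ Ω) :=
    (hXx.comp continuousOn_snd hm).add (continuousOn_fst.smul (hVx.comp continuousOn_snd hm))
  have hcB : ContinuousOn (Function.uncurry B) (Set.univ ×ˢ Ω) :=
    (hXy.comp continuousOn_snd hm).add (continuousOn_fst.smul (hVy.comp continuousOn_snd hm))
  have hcVx : ContinuousOn (fun p : ℝ × ℂ => dX V p.2) (Set.univ ×ˢ Ω) :=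
    hVx.comp continuousOn_snd hm
  have hcVy : ContinuousOn (fun p : ℝ × ℂ => dY V p.2) (Set.univ ×ˢ Ω) :=
    hVy.comp continuousOn_snd hm
  have hdot {a b : ℝ × ℂ → Fin 4 → ℝ} {s : Set (ℝ × ℂ)} (ha : ContinuousOn a s)
      (hb : ContinuousOn b s) : ContinuousOn (fun p => a p ⬝ᵥ b p) s :=
    continuousOn_finsetSum _ fun i _ =>
      (continuousOn_pi.1 ha i).mul (continuousOn_pi.1 hb i)
  have h := hasDerivAt_setIntegral_sqrt (K := tsupport V)
    (P := fun t z => (A t z ⬝ᵥ A t z) * (B t z ⬝ᵥ B t z) - (A t z ⬝ᵥ B t z) ^ 2)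
    (P' := fun t z => (dX V z ⬝ᵥ A t z + A t z ⬝ᵥ dX V z) * (B t z ⬝ᵥ B t z)
      + (A t z ⬝ᵥ A t z) * (dY V z ⬝ᵥ B t z + B t z ⬝ᵥ dY V z)
      - 2 * (A t z ⬝ᵥ B t z) * (dX V z ⬝ᵥ B t z + A t z ⬝ᵥ dY V z))
    hΩ hVc hVΩ ?_ ?_ ?_ ?_
  · have hK : MeasurableSet (tsupport V) := (isClosed_tsupport V).measurableSet
    have e1 (t : ℝ) : ∫ z in tsupport V, areaDensity (fun w => X w + t • V w) z
        = ∫ z in tsupport V,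
          √((A t z ⬝ᵥ A t z) * (B t z ⬝ᵥ B t z) - (A t z ⬝ᵥ B t z) ^ 2) := by
      refine setIntegral_congr_fun hK fun z hz => ?_
      have hd : DifferentiableAt ℝ X z :=
        (hX.smooth.contDiffAt (hΩ.mem_nhds (hVΩ hz))).differentiableAt (by simp)
      have hd' : DifferentiableAt ℝ V z := hV.contDiffAt.differentiableAt (by simp)
      simp only [areaDensity, dX, dY, fderiv_add_const_smul hd hd', A, B]
    have e2 : ∫ z, (dX X z ⬝ᵥ dX V z + dY X z ⬝ᵥ dY V z)
        = ∫ z in tsupport V, (dX X z ⬝ᵥ dX V z + dY X z ⬝ᵥ dY V z) := by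
      refine (setIntegral_eq_integral_of_forall_compl_eq_zero fun z hz => ?_).symm
      have : fderiv ℝ V z = 0 := by
        by_contra h0
        exact hz (support_fderiv_subset ℝ h0)
      simp [dX, dY, this]
    simp only [e1]
    rw [e2]
    convert h using 1
    -- At `t = 0` conformality makes the density `|X_x|²`, which cancels against the common factor
    -- of the derivative of the Gram determinant.
    refine setIntegral_congr_fun hK fun z hz => ?_
    have h1 := hX.norm_eq z (hVΩ hz)
    have h2 := hX.orthogonal z (hVΩ hz)
    have hne : dX X z ⬝ᵥ dX X z ≠ 0 := fun h0 =>
      hX.ne_zero z (hVΩ hz) (dotProduct_self_eq_zero.1 h0)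
    have hnn : 0 ≤ dX X z ⬝ᵥ dX X z := Finset.sum_nonneg fun i _ => mul_self_nonneg _
    simp only [A, B, zero_smul, add_zero, h2, ← h1]
    rw [zero_pow two_ne_zero, sub_zero, Real.sqrt_mul_self hnn, dotProduct_comm (dX V z),
      dotProduct_comm (dY V z)]
    field_simp
    ring
  · exact ((hdot hcA hcA).fun_mul (hdot hcB hcB)).fun_sub ((hdot hcA hcB).fun_pow 2)
  · exact ((((hdot hcVx hcA).fun_add (hdot hcA hcVx)).fun_mul (hdot hcB hcB)).fun_add
      ((hdot hcA hcA).fun_mul ((hdot hcVy hcB).fun_add (hdot hcB hcVy)))).fun_sub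
      ((continuousOn_const.fun_mul (hdot hcA hcB)).fun_mul
        ((hdot hcVx hcB).fun_add (hdot hcA hcVy)))
  · intro z _ t
    have hA := hasDerivAt_dotProduct_add_smul (dX X z) (dX X z) (dX V z) (dX V z) t
    have hB := hasDerivAt_dotProduct_add_smul (dY X z) (dY X z) (dY V z) (dY V z) t
    have hAB := hasDerivAt_dotProduct_add_smul (dX X z) (dY X z) (dX V z) (dY V z) t
    refine ((hA.mul hB).sub (hAB.pow 2)).congr_deriv ?_
    simp [A, B]
  · intro z hz
    have h1 := hX.norm_eq z (hVΩ hz)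
    have h2 := hX.orthogonal z (hVΩ hz)
    have hne : dX X z ⬝ᵥ dX X z ≠ 0 := fun h0 =>
      hX.ne_zero z (hVΩ hz) (dotProduct_self_eq_zero.1 h0)
    simp only [A, B, zero_smul, add_zero, h2, ← h1]
    rw [zero_pow two_ne_zero, sub_zero]
    exact mul_self_pos.2 hne

end AreaVariation

/-! ### Integration by parts for vector fields -/

section VectorIntegrals

open MeasureTheory

variable {Ω : Set ℂ} {f g : ℂ → Fin 4 → ℝ}

theorem tsupport_apply_subset (g : ℂ → Fin 4 → ℝ) (i : Fin 4) :
    tsupport (fun z => g z i) ⊆ tsupport g :=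
  closure_mono fun _ hz h0 => hz (congrFun h0 i)

theorem hasCompactSupport_apply (hgc : HasCompactSupport g) (i : Fin 4) :
    HasCompactSupport fun z => g z i :=
  hgc.of_isClosed_subset (isClosed_tsupport _) (tsupport_apply_subset g i)

theorem integrable_dotProduct (hΩ : IsOpen Ω) (hf : ContinuousOn f Ω) (hg : Continuous g)
    (hgc : HasCompactSupport g) (hgΩ : tsupport g ⊆ Ω) : Integrable fun z => f z ⬝ᵥ g z :=
  integrable_finsetSum _ fun i _ => integrable_mul_of_tsupport_subset hΩ (continuousOn_pi.1 hf i)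
    (continuous_pi_iff.1 hg i) (hasCompactSupport_apply hgc i)
    ((tsupport_apply_subset g i).trans hgΩ)

theorem fderiv_apply_apply {z : ℂ} (hf : DifferentiableAt ℝ f z) (v : ℂ) (i : Fin 4) :
    fderiv ℝ (fun z => f z i) z v = fderiv ℝ f z v i :=
  DFunLike.congr_fun (hasFDerivAt_pi'.1 hf.hasFDerivAt i).fderiv v

theorem integral_dotProduct_fderiv_eq_neg (hΩ : IsOpen Ω) (hf : ContDiffOn ℝ ∞ f Ω)
    (hg : ContDiff ℝ ∞ g) (hgc : HasCompactSupport g) (hgΩ : tsupport g ⊆ Ω) (v : ℂ) :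
    ∫ z, f z ⬝ᵥ fderiv ℝ g z v = -∫ z, fderiv ℝ f z v ⬝ᵥ g z := by
  have hfi (i : Fin 4) : ContDiffOn ℝ ∞ (fun z => f z i) Ω := contDiffOn_pi.1 hf i
  have hgi (i : Fin 4) : ContDiff ℝ ∞ (fun z => g z i) := contDiff_pi.1 hg i
  have hci (i : Fin 4) := hasCompactSupport_apply hgc i
  have hsi (i : Fin 4) : tsupport (fun z => g z i) ⊆ Ω := (tsupport_apply_subset g i).trans hgΩ
  have e1 : (fun z => f z ⬝ᵥ fderiv ℝ g z v)
      = fun z => ∑ i, f z i * fderiv ℝ (fun z => g z i) z v := by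
    funext z
    simp only [fderiv_apply_apply (hg.contDiffAt.differentiableAt (by simp))]
    rfl
  have e2 : (fun z => fderiv ℝ f z v ⬝ᵥ g z)
      = fun z => ∑ i, fderiv ℝ (fun z => f z i) z v * g z i := by
    funext z
    by_cases hz : z ∈ Ω
    · simp only [fderiv_apply_apply
        ((hf.contDiffAt (hΩ.mem_nhds hz)).differentiableAt (by simp))]
      rfl
    · have : g z = 0 := image_eq_zero_of_notMem_tsupport fun h => hz (hgΩ h)
      simp [this]
  rw [e1, e2, integral_finsetSum, integral_finsetSum, ← Finset.sum_neg_distrib]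
  · exact Finset.sum_congr rfl fun i _ =>
      integral_mul_fderiv_eq_neg hΩ (hfi i) (hgi i) (hci i) (hsi i) v
  · exact fun i _ => integrable_mul_of_tsupport_subset hΩ
      (((hfi i).continuousOn_fderiv_of_isOpen hΩ (by simp)).clm_apply continuousOn_const)
      (hgi i).continuous (hci i) (hsi i)
  · exact fun i _ => integrable_mul_of_tsupport_subset hΩ (hfi i).continuousOn
      (((hgi i).continuous_fderiv (by simp)).clm_apply continuous_const)
      ((hci i).fderiv_apply ℝ v) ((tsupport_fderiv_apply_subset ℝ v).trans (hsi i))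

end VectorIntegrals

/-! ### The Laplacian of `X` in terms of `a` -/

section Laplacian

variable {Ω : Set ℂ} {z₀ : ℂ} {α : ℂ → ℂ →L[ℝ] Aff ℝ} {F : ℂ → Matrix (Fin 4) (Fin 4) ℝ}
  {X : ℂ → Fin 4 → ℝ}

theorem IsFrameAt.fderiv_mulVec {z : ℂ} (h : IsFrameAt α F X z) (hα : DifferentiableAt ℝ α z)
    (u v : ℂ) : fderiv ℝ (fun w => F w *ᵥ (α w u).2) z v
      = F z *ᵥ (rot (α z v) *ᵥ (α z u).2 + (fderiv ℝ α z v u).2) := by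
  have hF (i j : Fin 4) : HasFDerivAt (fun w => F w i j) _ z :=
    hasFDerivAt_pi'.1 (hasFDerivAt_pi'.1 h.1.hasFDerivAt i) j
  have ht (i : Fin 4) : HasFDerivAt (fun w => (α w u).2 i) _ z :=
    hasFDerivAt_pi'.1 (hα.hasFDerivAt.clm_apply (hasFDerivAt_const u z)).snd i
  have hi (i : Fin 4) : HasFDerivAt (fun w => ∑ k, F w i k * (α w u).2 k) _ z :=
    HasFDerivAt.fun_sum fun k _ => (hF i k).mul (ht k)
  have hd : DifferentiableAt ℝ (fun w => F w *ᵥ (α w u).2) z :=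
    differentiableAt_pi.2 fun i => (hi i).differentiableAt
  have e (i j : Fin 4) : fderiv ℝ (fun w i j => F w i j) z v i j = (F z * rot (α z v)) i j :=
    congrFun (congrFun (h.2.2.1 v) i) j
  ext i
  rw [← fderiv_apply_apply hd, Matrix.mulVec_add, Matrix.mulVec_mulVec]
  refine (DFunLike.congr_fun (hi i).fderiv v).trans ?_
  simp [Finset.sum_add_distrib, e, Matrix.mulVec, dotProduct, mul_comm, add_comm]

theorem rot_gMk_mulVec (a b₁ b₂ b₃ : ℝ) (t s : Fin 4 → ℝ) : rot (gMk a b₁ b₂ b₃ t) *ᵥ s =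
    ![-(a + b₁) * s 1 - b₂ * s 2 - b₃ * s 3, (a + b₁) * s 0 + b₃ * s 2 - b₂ * s 3,
      b₂ * s 0 - b₃ * s 1 - (a - b₁) * s 3, b₃ * s 0 + b₂ * s 1 + (a - b₁) * s 2] := by
  simp only [rot, gMk_fst]
  ext i
  fin_cases i <;> simp [Matrix.mulVec, dotProduct, Fin.sum_univ_four] <;> ring

/-- The mean curvature of a conformal Lagrangian immersion, in terms of a lift. -/
theorem IsLCLI.laplacian_eq (hΩ : IsOpen Ω) (hα : ContDiffOn ℝ ∞ α Ω)
    (hg : ∀ z ∈ Ω, ∀ v, α z v ∈ lieG) (h : IsLCLI Ω z₀ F X) (hm : IsMaurerCartanForm Ω α F X)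
    {z : ℂ} (hz : z ∈ Ω) : fderiv ℝ (dX X) z 1 + fderiv ℝ (dY X) z Complex.I
      = (2 : ℝ) • Li ℝ *ᵥ (liCoeff (α z 1) • dX X z + liCoeff (α z Complex.I) • dY X z) := by
  have hn : Ω ∈ nhds z := hΩ.mem_nhds hz
  have hd : DifferentiableAt ℝ α z := (hα.contDiffAt hn).differentiableAt (by simp)
  have hf := h.isFrameAt hΩ hm hz
  have hx : dX X =ᶠ[nhds z] fun w => F w *ᵥ (α w 1).2 :=
    Filter.eventually_of_mem hn fun w hw => (h.isFrameAt hΩ hm hw).dX_eq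
  have hy : dY X =ᶠ[nhds z] fun w => F w *ᵥ (α w Complex.I).2 :=
    Filter.eventually_of_mem hn fun w hw => (h.isFrameAt hΩ hm hw).dY_eq
  have hsnd := Filter.eventually_of_mem hn fun w hw => h.snd_eq hΩ hm hw
  have hcurv : (fderiv ℝ α z 1 Complex.I).2 - (fderiv ℝ α z Complex.I 1).2
      + (rot (α z 1) *ᵥ (α z Complex.I).2 - rot (α z Complex.I) *ᵥ (α z 1).2) = 0 :=
    congrArg Prod.snd (h.isFlatFormAt hΩ hα hm hz 1 Complex.I)
  have key : rot (α z 1) *ᵥ (α z 1).2 + (fderiv ℝ α z 1 1).2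
      + (rot (α z Complex.I) *ᵥ (α z Complex.I).2 + (fderiv ℝ α z Complex.I Complex.I).2)
      = (2 : ℝ) • Li ℝ *ᵥ (liCoeff (α z 1) • (α z 1).2
        + liCoeff (α z Complex.I) • (α z Complex.I).2) := by
    rw [fderiv_snd_eq hd hsnd, h.snd_eq hΩ hm hz] at hcurv
    rw [fderiv_snd_eq hd hsnd, h.snd_eq hΩ hm hz]
    obtain ⟨a, b₁, b₂, b₃, h1⟩ := (mem_lieG_iff _).1 (hg z hz 1)
    obtain ⟨a', b₁', b₂', b₃', h2⟩ := (mem_lieG_iff _).1 (hg z hz Complex.I)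
    have e1 (s : Fin 4 → ℝ) := (congrArg (rot · *ᵥ s) h1).trans (rot_gMk_mulVec ..)
    have e2 (s : Fin 4 → ℝ) := (congrArg (rot · *ᵥ s) h2).trans (rot_gMk_mulVec ..)
    have e3 : liCoeff (α z 1) = a := by rw [h1, liCoeff_gMk]
    have e4 : liCoeff (α z Complex.I) = a' := by rw [h2, liCoeff_gMk]
    rw [e3, e4, e1, e2, Lj_mulVec, Lj_mulVec, Li_mulVec]
    rw [e1, e2, Lj_mulVec, Lj_mulVec] at hcurv
    have c0 := congrFun hcurv 0
    have c1 := congrFun hcurv 1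
    have c2 := congrFun hcurv 2
    have c3 := congrFun hcurv 3
    simp only [Pi.add_apply, Pi.sub_apply, Pi.zero_apply, Matrix.cons_val] at c0 c1 c2 c3
    ext i
    fin_cases i <;> simp only [Pi.add_apply, Pi.smul_apply, smul_eq_mul, Fin.mk_one, Fin.zero_eta,
      Fin.reduceFinMk, Matrix.cons_val]
    -- The four multiples are the entries of `-L_j` applied to the curvature relation. The `R` parts
    -- cancel because they commute with `L_j`; the `L_i` part doubles because it anticommutes.
    · linear_combination c2
    · linear_combination -c3
    · linear_combination -c0
    · linear_combination c1
  rw [hx.fderiv_eq, hy.fderiv_eq, hf.fderiv_mulVec hd, hf.fderiv_mulVec hd, ← Matrix.mulVec_add,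
    key, hf.dX_eq, hf.dY_eq]
  simp only [Matrix.mulVec_add, Matrix.mulVec_smul, Matrix.mulVec_mulVec,
    mul_Li_of_mem_rotGroup (h.mem_rotGroup z hz)]

end Laplacian

/-! ### Hamiltonian variations and stationarity -/

section HamiltonianVariation

open MeasureTheory

theorem dotProduct_Li_mulVec (x y : Fin 4 → ℝ) : (Li ℝ *ᵥ x) ⬝ᵥ y = -omega y x := by
  rw [omega, Li_mulVec, Li_mulVec]
  simp [dotProduct, Fin.sum_univ_four]
  ring

variable {Ω : Set ℂ} {z₀ : ℂ} {α : ℂ → ℂ →L[ℝ] Aff ℝ} {F : ℂ → Matrix (Fin 4) (Fin 4) ℝ}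
  {X : ℂ → Fin 4 → ℝ}

theorem contDiffOn_liCoeff (hα : ContDiffOn ℝ ∞ α Ω) (u : ℂ) :
    ContDiffOn ℝ ∞ (fun z => liCoeff (α z u)) Ω :=
  liCoeff.contDiff.comp_contDiffOn (hα.clm_apply contDiffOn_const)

theorem fderiv_liCoeff {z : ℂ} (hα : DifferentiableAt ℝ α z) (u v : ℂ) :
    fderiv ℝ (fun z => liCoeff (α z u)) z v = liCoeff (fderiv ℝ α z v u) := by
  have h : HasFDerivAt (fun z => liCoeff (α z u)) _ z :=
    liCoeff.hasFDerivAt.comp z (hα.hasFDerivAt.clm_apply (hasFDerivAt_const u z))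
  rw [h.fderiv]
  simp

/-- The first variation of the area under a Hamiltonian variation with Hamiltonian `h`. -/
theorem IsLCLI.integral_eq (hΩ : IsOpen Ω) (hα : ContDiffOn ℝ ∞ α Ω)
    (hg : ∀ z ∈ Ω, ∀ v, α z v ∈ lieG) (hU : IsLCLI Ω z₀ F X) (hm : IsMaurerCartanForm Ω α F X)
    {V : ℂ → Fin 4 → ℝ} (hV : ContDiff ℝ ∞ V) (hVc : HasCompactSupport V) (hVΩ : tsupport V ⊆ Ω)
    {h : ℂ → ℝ} (hh : ContDiff ℝ ∞ h) (hhc : HasCompactSupport h) (hhΩ : tsupport h ⊆ Ω)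
    (hVh : ∀ z ∈ Ω, ∀ v : ℂ, omega (V z) (fderiv ℝ X z v) = fderiv ℝ h z v) :
    ∫ z, (dX X z ⬝ᵥ dX V z + dY X z ⬝ᵥ dY V z) = -2 * ∫ z, h z •
      (liCoeff (fderiv ℝ α z 1 1) + liCoeff (fderiv ℝ α z Complex.I Complex.I)) := by
  have hXx := contDiffOn_dX hΩ hU.immersion.smooth
  have hXy := contDiffOn_dY hΩ hU.immersion.smooth
  have hVs (v : ℂ) : Continuous fun z => fderiv ℝ V z v :=
    (hV.continuous_fderiv (by simp)).clm_apply continuous_const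
  have hhs (v : ℂ) : Continuous fun z => fderiv ℝ h z v :=
    (hh.continuous_fderiv (by simp)).clm_apply continuous_const
  have hc {G : Type} [NormedAddCommGroup G] [NormedSpace ℝ G] {f : ℂ → G}
      (hf : ContDiffOn ℝ ∞ f Ω) (v : ℂ) : ContinuousOn (fun z => fderiv ℝ f z v) Ω :=
    (hf.continuousOn_fderiv_of_isOpen hΩ (by simp)).clm_apply continuousOn_const
  have ha (u : ℂ) := contDiffOn_liCoeff hα u
  -- `⟨ΔX, V⟩ = 2⟨L_i (a_x X_x + a_y X_y), V⟩ = -2 ω(V, a_x X_x + a_y X_y)`, and `ω(V, dX) = dh`.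
  -- Outside `Ω` both sides vanish by the support conditions.
  have hpt (z : ℂ) : fderiv ℝ (dX X) z 1 ⬝ᵥ V z + fderiv ℝ (dY X) z Complex.I ⬝ᵥ V z
      = -2 * (liCoeff (α z 1) * fderiv ℝ h z 1
        + liCoeff (α z Complex.I) * fderiv ℝ h z Complex.I) := by
    by_cases hz : z ∈ Ω
    · rw [← add_dotProduct, hU.laplacian_eq hΩ hα hg hm hz, smul_dotProduct, Matrix.mulVec_add,
        Matrix.mulVec_smul, Matrix.mulVec_smul, add_dotProduct, smul_dotProduct, smul_dotProduct,
        dotProduct_Li_mulVec, dotProduct_Li_mulVec, dX, dY, hVh z hz, hVh z hz]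
      simp only [smul_eq_mul]
      ring
    · have h1 : V z = 0 := image_eq_zero_of_notMem_tsupport fun h => hz (hVΩ h)
      have h2 : fderiv ℝ h z = 0 := by
        by_contra h0
        exact hz (hhΩ (support_fderiv_subset ℝ h0))
      simp [h1, h2]
  have hpt' (z : ℂ) : fderiv ℝ (fun z => liCoeff (α z 1)) z 1 * h z
      + fderiv ℝ (fun z => liCoeff (α z Complex.I)) z Complex.I * h z = h z •
        (liCoeff (fderiv ℝ α z 1 1) + liCoeff (fderiv ℝ α z Complex.I Complex.I)) := by
    by_cases hz : z ∈ Ω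
    · have hd : DifferentiableAt ℝ α z :=
        (hα.contDiffAt (hΩ.mem_nhds hz)).differentiableAt (by simp)
      rw [fderiv_liCoeff hd, fderiv_liCoeff hd, smul_eq_mul]
      ring
    · have h1 : h z = 0 := image_eq_zero_of_notMem_tsupport fun h => hz (hhΩ h)
      simp [h1]
  -- Two integrations by parts: one moves the derivatives from `V` to `dX`, the other from `h` to
  -- `a`.
  calc ∫ z, (dX X z ⬝ᵥ dX V z + dY X z ⬝ᵥ dY V z)
      = (∫ z, dX X z ⬝ᵥ dX V z) + ∫ z, dY X z ⬝ᵥ dY V z :=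
        integral_add
          (integrable_dotProduct hΩ hXx.continuousOn (hVs 1) (hVc.fderiv_apply ℝ 1)
            ((tsupport_fderiv_apply_subset ℝ 1).trans hVΩ))
          (integrable_dotProduct hΩ hXy.continuousOn (hVs Complex.I)
            (hVc.fderiv_apply ℝ Complex.I)
            ((tsupport_fderiv_apply_subset ℝ Complex.I).trans hVΩ))
    _ = (-∫ z, fderiv ℝ (dX X) z 1 ⬝ᵥ V z) + -∫ z, fderiv ℝ (dY X) z Complex.I ⬝ᵥ V z :=
        congrArg₂ (· + ·) (integral_dotProduct_fderiv_eq_neg hΩ hXx hV hVc hVΩ 1)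
          (integral_dotProduct_fderiv_eq_neg hΩ hXy hV hVc hVΩ Complex.I)
    _ = -∫ z, (fderiv ℝ (dX X) z 1 ⬝ᵥ V z + fderiv ℝ (dY X) z Complex.I ⬝ᵥ V z) := by
        rw [integral_add (integrable_dotProduct hΩ (hc hXx 1) hV.continuous hVc hVΩ)
          (integrable_dotProduct hΩ (hc hXy Complex.I) hV.continuous hVc hVΩ), neg_add]
    _ = 2 * ∫ z, (liCoeff (α z 1) * fderiv ℝ h z 1
          + liCoeff (α z Complex.I) * fderiv ℝ h z Complex.I) := by
        simp only [hpt]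
        rw [integral_const_mul]
        ring
    _ = 2 * ((∫ z, liCoeff (α z 1) * fderiv ℝ h z 1)
          + ∫ z, liCoeff (α z Complex.I) * fderiv ℝ h z Complex.I) := by
        rw [integral_add
          (integrable_mul_of_tsupport_subset hΩ (ha 1).continuousOn (hhs 1)
            (hhc.fderiv_apply ℝ 1) ((tsupport_fderiv_apply_subset ℝ 1).trans hhΩ))
          (integrable_mul_of_tsupport_subset hΩ (ha Complex.I).continuousOn (hhs Complex.I)
            (hhc.fderiv_apply ℝ Complex.I)
            ((tsupport_fderiv_apply_subset ℝ Complex.I).trans hhΩ))]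
    _ = -2 * ∫ z, (fderiv ℝ (fun z => liCoeff (α z 1)) z 1 * h z
          + fderiv ℝ (fun z => liCoeff (α z Complex.I)) z Complex.I * h z) := by
        rw [integral_mul_fderiv_eq_neg hΩ (ha 1) hh hhc hhΩ,
          integral_mul_fderiv_eq_neg hΩ (ha Complex.I) hh hhc hhΩ,
          integral_add (integrable_mul_of_tsupport_subset hΩ (hc (ha 1) 1) hh.continuous hhc hhΩ)
            (integrable_mul_of_tsupport_subset hΩ (hc (ha Complex.I) Complex.I) hh.continuous hhc
              hhΩ)]
        ring
    _ = _ := by simp only [hpt']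

/-- The Hamiltonian vector field along a conformal Lagrangian immersion that is normal to it and has
Hamiltonian `h`. -/
def normalHamiltonianField (X : ℂ → Fin 4 → ℝ) (h : ℂ → ℝ) (z : ℂ) : Fin 4 → ℝ :=
  -((dX X z ⬝ᵥ dX X z)⁻¹ •
    (Li ℝ *ᵥ (fderiv ℝ h z 1 • dX X z + fderiv ℝ h z Complex.I • dY X z)))

/-- Since `L_i² = -1`, pairing with `ω` turns the field into the gradient of `h` for the induced
metric, of conformal factor `|X_x|²`. The field vanishes off the support of `h`, so it is smooth on
the whole plane although `X` is smooth on `Ω` only. -/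
theorem normalHamiltonianField_spec (hΩ : IsOpen Ω)
    (hX : IsConformalLagrangianImmersion Ω X) {h : ℂ → ℝ} (hh : ContDiff ℝ ∞ h)
    (hhc : HasCompactSupport h) (hhΩ : tsupport h ⊆ Ω) :
    ContDiff ℝ ∞ (normalHamiltonianField X h) ∧ HasCompactSupport (normalHamiltonianField X h) ∧
      tsupport (normalHamiltonianField X h) ⊆ Ω ∧ ∀ z ∈ Ω, ∀ v : ℂ,
        omega (normalHamiltonianField X h z) (fderiv ℝ X z v) = fderiv ℝ h z v := by
  have hXx := contDiffOn_dX hΩ hX.smooth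
  have hXy := contDiffOn_dY hΩ hX.smooth
  have hne {z : ℂ} (hz : z ∈ Ω) : dX X z ⬝ᵥ dX X z ≠ 0 := fun h0 =>
    hX.ne_zero z hz (dotProduct_self_eq_zero.1 h0)
  have hsupp : Function.support (normalHamiltonianField X h) ⊆ tsupport h := by
    intro z hz
    by_contra hz'
    have h0 : fderiv ℝ h z = 0 := by
      by_contra h0
      exact hz' (support_fderiv_subset ℝ h0)
    exact hz (by simp [normalHamiltonianField, h0])
  have htsupp : tsupport (normalHamiltonianField X h) ⊆ tsupport h :=
    closure_minimal hsupp (isClosed_tsupport h)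
  have hhs (v : ℂ) : ContDiff ℝ ∞ fun z => fderiv ℝ h z v :=
    (hh.fderiv_right (by simp)).clm_apply contDiff_const
  have hL : ContDiff ℝ ∞ fun x : Fin 4 → ℝ => Li ℝ *ᵥ x :=
    (LinearMap.toContinuousLinearMap (Matrix.mulVecLin (Li ℝ))).contDiff
  have hdot : ContDiffOn ℝ ∞ (fun z => dX X z ⬝ᵥ dX X z) Ω :=
    ContDiffOn.sum fun i _ => (contDiffOn_pi.1 hXx i).mul (contDiffOn_pi.1 hXx i)
  have hsm : ContDiffOn ℝ ∞ (normalHamiltonianField X h) Ω :=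
    ((hdot.inv fun z hz => hne hz).smul (hL.comp_contDiffOn
      (((hhs 1).contDiffOn.smul hXx).add ((hhs Complex.I).contDiffOn.smul hXy)))).neg
  have hat (z : ℂ) : ContDiffAt ℝ ∞ (normalHamiltonianField X h) z := by
    by_cases hz : z ∈ tsupport (normalHamiltonianField X h)
    · exact hsm.contDiffAt (hΩ.mem_nhds (hhΩ (htsupp hz)))
    · exact contDiffAt_const.congr_of_eventuallyEq (notMem_tsupport_iff_eventuallyEq.1 hz)
  refine ⟨contDiff_iff_contDiffAt.2 hat,
    hhc.of_isClosed_subset (isClosed_tsupport _) htsupp, htsupp.trans hhΩ,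
    fun z hz v => ?_⟩
  have e (θ : ℂ →L[ℝ] ℝ) : θ v = v.re * θ 1 + v.im * θ Complex.I := by
    have hv : v = v.re • (1 : ℂ) + v.im • Complex.I := by simp [Complex.re_add_im]
    conv_lhs => rw [hv, map_add, map_smul, map_smul]
    rfl
  have e' : fderiv ℝ X z v = v.re • dX X z + v.im • dY X z := by
    have hv : v = v.re • (1 : ℂ) + v.im • Complex.I := by simp [Complex.re_add_im]
    conv_lhs => rw [hv, map_add, map_smul, map_smul]
    rfl
  have hLL (x : Fin 4 → ℝ) : Li ℝ *ᵥ (Li ℝ *ᵥ x) = -x := by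
    rw [Li_mulVec, Li_mulVec]
    ext i
    fin_cases i <;> simp
  have h1 := hX.norm_eq z hz
  have h2 := hX.orthogonal z hz
  have h3 := hne hz
  rw [e (fderiv ℝ h z), e', omega, normalHamiltonianField, Matrix.mulVec_neg, Matrix.mulVec_smul,
    hLL, smul_neg, neg_neg]
  simp only [smul_dotProduct, add_dotProduct, dotProduct_add, dotProduct_smul, smul_eq_mul,
    dotProduct_comm (dY X z) (dX X z), h2, ← h1]
  field_simp
  ring

/-- An LCLI is Hamiltonian stationary iff the 1-form `liCoeff ∘ α` (half the differential of the
Lagrangian angle) is coclosed. -/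
theorem IsLCLI.isHamiltonianStationary_iff (hΩ : IsOpen Ω) (hα : ContDiffOn ℝ ∞ α Ω)
    (hg : ∀ z ∈ Ω, ∀ v, α z v ∈ lieG) (hU : IsLCLI Ω z₀ F X)
    (hm : IsMaurerCartanForm Ω α F X) : IsHamiltonianStationary Ω X ↔ ∀ z ∈ Ω,
      liCoeff (fderiv ℝ α z 1 1) + liCoeff (fderiv ℝ α z Complex.I Complex.I) = 0 := by
  constructor
  · intro hs
    have hcont : ContinuousOn (fun z => liCoeff (fderiv ℝ α z 1 1)
        + liCoeff (fderiv ℝ α z Complex.I Complex.I)) Ω := by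
      have h1 (u : ℂ) : ContinuousOn (fun z => liCoeff (fderiv ℝ α z u u)) Ω :=
        liCoeff.continuous.comp_continuousOn
          (((hα.continuousOn_fderiv_of_isOpen hΩ (by simp)).clm_apply continuousOn_const).clm_apply
            continuousOn_const)
      exact (h1 1).add (h1 Complex.I)
    -- Fundamental lemma of the calculus of variations, each test function being realised by its
    -- normal field. Continuity then upgrades vanishing almost everywhere to vanishing on `Ω`.
    have hae := hΩ.ae_eq_zero_of_integral_contDiff_smul_eq_zero (μ := volume)
      (hcont.locallyIntegrableOn hΩ.measurableSet) fun h hh hhc hhΩ => by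
        obtain ⟨hV, hVc, hVΩ, hVh⟩ := normalHamiltonianField_spec hΩ hU.immersion hh hhc hhΩ
        have h1 := (hasDerivAt_area hΩ hU.immersion hV hVc hVΩ).unique
          (hs _ ⟨hV, hVc, hVΩ, h, hh, hhc, hhΩ, hVh⟩)
        rw [hU.integral_eq hΩ hα hg hm hV hVc hVΩ hh hhc hhΩ hVh] at h1
        simpa using h1
    exact Measure.eqOn_open_of_ae_eq ((ae_restrict_iff' hΩ.measurableSet).2 hae) hΩ hcont
      continuousOn_const
  · rintro hdiv V ⟨hV, hVc, hVΩ, h, hh, hhc, hhΩ, hVh⟩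
    have h1 := hasDerivAt_area hΩ hU.immersion hV hVc hVΩ
    rw [hU.integral_eq hΩ hα hg hm hV hVc hVΩ hh hhc hhΩ hVh] at h1
    have h2 (z : ℂ) : h z •
        (liCoeff (fderiv ℝ α z 1 1) + liCoeff (fderiv ℝ α z Complex.I Complex.I)) = 0 := by
      by_cases hz : z ∈ Ω
      · simp [hdiv z hz]
      · have : h z = 0 := image_eq_zero_of_notMem_tsupport fun h => hz (hhΩ h)
        simp [this]
    simp only [h2, integral_zero, mul_zero] at h1
    exact h1

end HamiltonianVariation

end HamStat

end

/-! ### The main theorem -/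

theorem theorem2 (Ω : Set ℂ) (hΩ : IsOpen Ω) (hΩs : IsSimplyConnected Ω) (z₀ : ℂ) (hz₀ : z₀ ∈ Ω)
    (α : ℂ → ℂ →L[ℝ] HamStat.Aff ℝ) (hα : ContDiffOn ℝ ∞ α Ω)
    (hαg : ∀ z ∈ Ω, ∀ v : ℂ, α z v ∈ HamStat.lieG) :
    ((∃ (F : ℂ → Matrix (Fin 4) (Fin 4) ℝ) (X : ℂ → Fin 4 → ℝ),
        HamStat.IsLCLI Ω z₀ F X ∧ HamStat.IsMaurerCartanForm Ω α F X) ↔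
      HamStat.IsFlatOn Ω (HamStat.complexForm α) ∧
        (∀ z ∈ Ω, HamStat.dzbarPart (HamStat.component α (-1) z) = 0) ∧
        (∀ z ∈ Ω, HamStat.dzPart (HamStat.component α 1 z) = 0) ∧
        (∀ z ∈ Ω, HamStat.dzPart (HamStat.component α (-1) z) ≠ 0) ∧
        (∀ z ∈ Ω, HamStat.dzbarPart (HamStat.component α 1 z) ≠ 0)) ∧
    ((∃ (F : ℂ → Matrix (Fin 4) (Fin 4) ℝ) (X : ℂ → Fin 4 → ℝ),
        HamStat.IsLCLI Ω z₀ F X ∧ HamStat.IsMaurerCartanForm Ω α F X) →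
      ((∃ (F : ℂ → Matrix (Fin 4) (Fin 4) ℝ) (X : ℂ → Fin 4 → ℝ),
          HamStat.IsLCLI Ω z₀ F X ∧ HamStat.IsMaurerCartanForm Ω α F X ∧
            HamStat.IsHamiltonianStationary Ω X) ↔
        ∀ l : ℂ, l ≠ 0 → HamStat.IsFlatOn Ω (HamStat.extendedForm α l))) ∧
    (∀ (F : ℂ → Matrix (Fin 4) (Fin 4) ℝ) (X : ℂ → Fin 4 → ℝ),
      HamStat.IsLCLI Ω z₀ F X → HamStat.IsMaurerCartanForm Ω α F X →
        (HamStat.IsHamiltonianStationary Ω X ↔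
          ∀ l : ℂ, l ≠ 0 → HamStat.IsFlatOn Ω (HamStat.extendedForm α l))) := by

  open HamStat in
  -- Both sides are equivalent to coclosedness of `a`, a condition on `α` alone; hence stationarity
  -- does not depend on the chosen LCLI with this form.
  have hstat (F : ℂ → Matrix (Fin 4) (Fin 4) ℝ) (X : ℂ → Fin 4 → ℝ) (hU : IsLCLI Ω z₀ F X)
      (hm : IsMaurerCartanForm Ω α F X) : IsHamiltonianStationary Ω X ↔
        ∀ l : ℂ, l ≠ 0 → IsFlatOn Ω (extendedForm α l) :=
    (hU.isHamiltonianStationary_iff hΩ hα hαg hm).trans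
      (forall_isFlatOn_extendedForm_iff hΩ hα hαg (fun _ hz => hU.snd_eq hΩ hm hz)
        fun _ hz => hU.isFlatFormAt hΩ hα hm hz).symm
  refine ⟨⟨?_, ?_⟩, ?_, hstat⟩
  · rintro ⟨F, X, hU, hm⟩
    have ht {z : ℂ} (hz : z ∈ Ω) := hU.snd_eq hΩ hm hz
    have hne {z : ℂ} (hz : z ∈ Ω) := hU.snd_ne_zero hΩ hm hz
    exact ⟨(HamStat.isFlatOn_complexForm_iff hΩ hα).2 fun z hz => hU.isFlatFormAt hΩ hα hm hz,
      fun z hz => (HamStat.dzbarPart_component_neg_one_eq_zero_iff (hαg z hz)).2 (ht hz),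
      fun z hz => (HamStat.dzPart_component_one_eq_zero_iff (hαg z hz)).2 (ht hz),
      fun z hz h => hne hz
        ((HamStat.dzPart_component_neg_one_eq_zero_iff (hαg z hz) (ht hz)).1 h),
      fun z hz h => hne hz
        ((HamStat.dzbarPart_component_one_eq_zero_iff (hαg z hz) (ht hz)).1 h)⟩
  · rintro ⟨hf, h1, -, h2, -⟩
    have ht (z : ℂ) (hz : z ∈ Ω) :=
      (HamStat.dzbarPart_component_neg_one_eq_zero_iff (hαg z hz)).1 (h1 z hz)
    exact HamStat.exists_isLCLI hΩ hΩs hz₀ hα hαg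
      ((HamStat.isFlatOn_complexForm_iff hΩ hα).1 hf) ht fun z hz h => h2 z hz
        ((HamStat.dzPart_component_neg_one_eq_zero_iff (hαg z hz) (ht z hz)).2 h)
  · rintro ⟨F, X, hU, hm⟩
    exact ⟨fun ⟨F', X', hU', hm', hs⟩ => (hstat F' X' hU' hm').1 hs,
      fun h => ⟨F, X, hU, hm, (hstat F X hU hm).2 h⟩⟩
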